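/- **Setting.** Consider the plant $\dot x=f(x)+g(x)u$, $z=q(x)$ with $x\in\mathcal X\subset\mathbb R^{n_x}$, $u\in\mathbb R^{n_u}$, $z\in\mathbb R^{n_z}$, and the observer $$\dot{\hat x}=f(\hat x)+g(\hat x)u+S^{-1}C^\top R^{-1}[z-q(\hat x)],\qquad \hat x\in\hat{\mathcal X},\quad S=P^{-1},$$ $$\dot P=\kappa P+AP+PA^\top-PC^\top R^{-1}CP+Q,\qquad A=\tfrac{\partial f}{\partial x}(\hat x)+\tfrac{\partial g}{\partial x}(\hat x)u,\quad C=\tfrac{\partial q}{\partial x}(\hat x),$$ where $\mathcal X,\hat{\mathcal X}$ and $\emptyset\ne\mathcal U\subset\mathbb R^{n_u}$ are compact, $f,g,q$ are of class $C^2$ on a neighbourhood of $\mathcal X\cup\hat{\mathcal X}$, $0\in\mathcal X$, $f(0)=0$, $q(0)=0$, $\kappa\ge 0$, $Q,R$ are symmetric positive definite, and $R\ge\underline r I$ with $\underline r>0$. Time runs in $\mathcal I=[0,t_{\max})$, $0<t_{\max}\le\infty$. *Bounds.* There are fixed $\underline p,\bar p>0$ with $\underline p I\le P(t)\le\bar p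 I$ for $t\in\mathcal I$. *CLF.* $V$ is a $C^2$ positive definite function on (a neighbourhood of) $\mathcal X\cup\hat{\mathcal X}$ and $\gamma>0$; there are class-$\mathcal K$ functions $\alpha_1,\alpha_2$ such that $\alpha_1(\|x\|)\le V(x)\le\alpha_2(\|x\|)$ and $\inf_{u\in\mathcal U}(L_fV(x)+L_gV(x)u+\gamma V(x))\le0$ for all $x\in\mathcal X\cup\hat{\mathcal X}$. *CBF.* $h$ is a $C^2$ function on (a neighbourhood of) $\mathcal X\cup\hat{\mathcal X}$, $\mathcal S=\{x\in\mathcal X:h(x)\ge0\}$ has nonempty interior, $L_gh(x)\neq0$ for all $x\in\mathcal X\cup\hat{\mathcal X}$, and $\alpha>0$. Relative to an error bound $\|x(t)-\hat x(t)\|\le M(t)$ with $M(t)=\eta\|x(0)-\hat x(0)\|e^{-\theta t}$, $h$ is called a CBF if moreover $\alpha\le\theta$ and $\sup_{u\in\mathcal U}(L_fh(x)+L_gh(x)u-\underline r^{-1}\bar pK_hK_q^2M(0))\ge-\alpha h(x)$ for all $x\in\mathcal S$, where $K_h,K_q$ are Lipschitz constants of $h,q$ on $\mathcal X\cup\hat{\mathcal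 X}$. *Program.* Let $c_1\ge0$, $c_2>0$, $\Delta t>0$. With $S=S(t)$, and with $S(t+\Delta t)$ denoting the first-order prediction $$S(t+\Delta t)=S+\Delta t\,[-\kappa S-A^\top S-SA+C^\top R^{-1}C-SQS],$$ the program (P1) at $(t,\hat x,z)$ minimizes $u^\top u-c_1\lambda_{\min}(S(t+\Delta t))+c_2\delta^2$ over $(u,\delta)\in\mathbb R^{n_u}\times\mathbb R$ subject to $$L_fV(\hat x)+L_gV(\hat x)u+\gamma V(\hat x)\le\delta,\qquad L_fh(\hat x)+L_gh(\hat x)u+\alpha h(\hat x)+\nabla h(\hat x)^\top S^{-1}C^\top R^{-1}[z-q(\hat x)]\ge0 .$$ **Theorem.** (i) Let $P$ be piecewise continuous on $\mathcal I$ (as every solution of the Riccati equation is) and satisfy the bounds. For all $t\in\mathcal I$, $\hat x\in\hat{\mathcal X}$, $z\in\mathbb R^{n_z}$, (P1) is feasible and has a unique minimizer. Let $\pi(t,\hat x,z)$ be its $u$-component. For fixed $(\hat x,z)$, $\pi$ is piecewise continuous in $t\in\mathcal I$. Let $Z\subset\mathbb R^{n_z}$ and $J\subset\mathcal I$ be compact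 with $P$ continuous on $J$ (for example $J=\{t\}$), and suppose that for all $t\in J$, $\hat x\in\hat{\mathcal X}$, $z\in Z$ the matrix $S(t)$ has distinct eigenvalues and so has the matrix $S(t+\Delta t)$ at $u=\pi(t,\hat x,z)$. Then $\pi(t,\cdot,\cdot)$ is Lipschitz on $\hat{\mathcal X}\times Z$, with a constant that does not depend on $t\in J$. (ii) There are $\epsilon,\eta>0$ and $\theta>\kappa/2$ such that every solution on some $\mathcal I$ of plant, observer and Riccati equation in closed loop with $u=\pi(t,\hat x,z)$, with $P$ satisfying the bounds, $x(t)\in\mathcal X$ and $\hat x(t)\in\hat{\mathcal X}$, satisfies the error bound: if $\|x(0)-\hat x(0)\|<\epsilon$, then $\|x(t)-\hat x(t)\|\le\eta\|x(0)-\hat x(0)\|e^{-\theta t}$ for all $t\in\mathcal I$. (iii) Let $\epsilon,\eta>0$, $\theta>\kappa/2$, and consider a closed-loop solution as in (ii) that satisfies the error bound with these constants, and for which $h$ is a CBF relative to it. If $x(0)\in\mathcal S$, $h(x(0))\ge2K_hM(0)$, $\hat x(0)\in\hat{\mathcal X}$ and $\|x(0)-\hat x(0)\|<\epsilon$, then the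 system is safe: $x(t)\in\mathcal S$ for all $t\in\mathcal I$. -/

import Mathlib

open Set Filter Topology
open scoped NNReal InnerProductSpace

/-- Euclidean space `ℝⁿ`. -/
abbrev Vec (n : ℕ) : Type := EuclideanSpace ℝ (Fin n)

/-- `m × n` real matrices, seen as linear maps `ℝⁿ → ℝᵐ`; the transpose is the adjoint. -/
abbrev Mat (m n : ℕ) : Type := Vec n →L[ℝ] Vec m

/-- Transpose of a matrix. -/
noncomputable abbrev transp {m n : ℕ} (A : Mat m n) : Mat n m := ContinuousLinearMap.adjoint A

/-- Inverse of a square matrix. -/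
noncomputable abbrev minv {n : ℕ} (A : Mat n n) : Mat n n := ContinuousLinearMap.inverse A

/-- Symmetric positive definite matrices. -/
def SymPosDef {n : ℕ} (A : Mat n n) : Prop :=
  IsSelfAdjoint A ∧ ∀ v : Vec n, v ≠ 0 → 0 < ⟪A v, v⟫_ℝ

/-- Smallest (real) eigenvalue of a square matrix. -/
noncomputable def lambdaMin {n : ℕ} (A : Mat n n) : ℝ :=
  sInf {μ : ℝ | Module.End.HasEigenvalue (A : Vec n →ₗ[ℝ] Vec n) μ}

/-- All eigenvalues are simple. For a symmetric matrix, which is diagonalizable, this says that its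
`n` eigenvalues counted with multiplicity are pairwise distinct. -/
def DistinctEigenvalues {n : ℕ} (A : Mat n n) : Prop :=
  ∀ μ : ℝ, Module.finrank ℝ (Module.End.eigenspace (A : Vec n →ₗ[ℝ] Vec n) μ) ≤ 1

/-- `φ` is of class `C²` on (an open neighbourhood of) the set `K`. -/
def IsC2On {E F : Type*} [NormedAddCommGroup E] [NormedSpace ℝ E] [NormedAddCommGroup F]
    [NormedSpace ℝ F] (φ : E → F) (K : Set E) : Prop :=
  ∃ D : Set E, IsOpen D ∧ K ⊆ D ∧ ContDiffOn ℝ 2 φ D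

/-- Class `𝒦` functions on `[0, ∞)`. -/
def ClassK (a : ℝ → ℝ) : Prop :=
  ContinuousOn a (Ici 0) ∧ StrictMonoOn a (Ici 0) ∧ a 0 = 0

/-- The time interval `[0, tmax)`, with `tmax = ∞` allowed. -/
def timeInterval (tmax : EReal) : Set ℝ := {t : ℝ | 0 ≤ t ∧ (t : EReal) < tmax}

/-- Piecewise continuity on a time interval `I` that starts at `0`: on each `[0, T]` with `T ∈ I`
there are only finitely many discontinuities, and all one-sided limits exist. -/
def PiecewiseContinuousOn {Y : Type*} [TopologicalSpace Y] (φ : ℝ → Y) (I : Set ℝ) : Prop :=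
  ∀ T ∈ I,
    (∃ F : Finset ℝ, ∀ t ∈ Icc 0 T, t ∉ F → ContinuousWithinAt φ I t) ∧
    (∀ t ∈ Icc 0 T,
      (∃ y, Tendsto φ (𝓝[I ∩ Iio t] t) (𝓝 y)) ∧ (∃ y, Tendsto φ (𝓝[I ∩ Ioi t] t) (𝓝 y)))

/-- The data of the problem: plant, constraint sets, observer, candidate Lyapunov and barrier
functions, and the parameters of the optimization program. -/
structure Problem (nx nu nz : ℕ) where
  /-- drift -/
  f : Vec nx → Vec nx
  /-- input matrix -/
  g : Vec nx → Mat nx nu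
  /-- output map -/
  q : Vec nx → Vec nz
  /-- states -/
  X : Set (Vec nx)
  /-- estimated states -/
  Xhat : Set (Vec nx)
  /-- admissible inputs -/
  U : Set (Vec nu)
  /-- exponential weight of the observer -/
  κ : ℝ
  /-- weights of the observer -/
  Q : Mat nx nx
  R : Mat nz nz
  /-- lower bound of `R` -/
  rlow : ℝ
  /-- lower and upper bound of the uncertainty -/
  plow : ℝ
  phigh : ℝ
  /-- candidate control Lyapunov function and its rate -/
  V : Vec nx → ℝ
  γ : ℝ
  /-- candidate control barrier function and its rate -/
  h : Vec nx → ℝ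
  α : ℝ
  /-- weights of the program -/
  c₁ : ℝ
  c₂ : ℝ
  /-- time between two consecutive inputs -/
  Δt : ℝ

namespace Problem

variable {nx nu nz : ℕ} (p : Problem nx nu nz)

/-- The set on which states and estimates live. -/
def dom : Set (Vec nx) := p.X ∪ p.Xhat

/-- Lie derivative of `W` along the drift, `∇W(x)ᵀ f(x)`. -/
noncomputable def Lf (W : Vec nx → ℝ) (x : Vec nx) : ℝ := fderiv ℝ W x (p.f x)

/-- Lie derivative of `W` along the input fields, the row vector `∇W(x)ᵀ g(x)`. -/
noncomputable def Lg (W : Vec nx → ℝ) (x : Vec nx) : Vec nu →L[ℝ] ℝ := (fderiv ℝ W x).comp (p.g x)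

/-- Standing assumptions on plant, constraint sets, observer and program. -/
structure Standing : Prop where
  compact_X : IsCompact p.X
  compact_Xhat : IsCompact p.Xhat
  compact_U : IsCompact p.U
  nonempty_U : p.U.Nonempty
  smooth_f : IsC2On p.f p.dom
  smooth_g : IsC2On p.g p.dom
  smooth_q : IsC2On p.q p.dom
  zero_mem : (0 : Vec nx) ∈ p.X
  equilibrium : p.f 0 = 0
  output_zero : p.q 0 = 0
  κ_nonneg : 0 ≤ p.κ
  Q_pos : SymPosDef p.Q
  R_pos : SymPosDef p.R
  rlow_pos : 0 < p.rlow
  rlow_le : p.rlow • (1 : Mat nz nz) ≤ p.R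
  plow_pos : 0 < p.plow
  phigh_pos : 0 < p.phigh
  c₁_nonneg : 0 ≤ p.c₁
  c₂_pos : 0 < p.c₂
  Δt_pos : 0 < p.Δt

/-- `V` is an observer-based exponentially stabilizing control Lyapunov function with rate `γ`. -/
structure IsCLF : Prop where
  smooth : IsC2On p.V p.dom
  zero : p.V 0 = 0
  pos : ∀ x ∈ p.dom, x ≠ 0 → 0 < p.V x
  γ_pos : 0 < p.γ
  bounds : ∃ a₁ a₂ : ℝ → ℝ, ClassK a₁ ∧ ClassK a₂ ∧
    ∀ x ∈ p.dom, a₁ ‖x‖ ≤ p.V x ∧ p.V x ≤ a₂ ‖x‖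
  decrease : ∀ x ∈ p.dom,
    sInf ((fun u => p.Lf p.V x + p.Lg p.V x u + p.γ * p.V x) '' p.U) ≤ 0

/-- The safe set `𝒮 = {x ∈ 𝒳 : h(x) ≥ 0}`. -/
def safeSet : Set (Vec nx) := {x ∈ p.X | 0 ≤ p.h x}

/-- The part of the notion of barrier function that does not involve the estimation error: `h` is
`C²`, the plant has relative degree one with respect to `h`, the safe set has an interior point,
and the rate `α` is positive. -/
structure IsBarrierCandidate : Prop where
  smooth : IsC2On p.h p.dom
  relDegreeOne : ∀ x ∈ p.dom, p.Lg p.h x ≠ 0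
  interior_nonempty : (interior p.safeSet).Nonempty
  α_pos : 0 < p.α

/-- `h` is an observer-based control barrier function with rate `α`, for the error bound
`‖ζ(t)‖ ≤ M₀ exp (-θ t)`; `Kh` and `Kq` are Lipschitz constants of `h` and `q`. -/
structure IsCBF (θ M₀ : ℝ) (Kh Kq : ℝ≥0) : Prop extends p.IsBarrierCandidate where
  lipschitz_h : LipschitzOnWith Kh p.h p.dom
  lipschitz_q : LipschitzOnWith Kq p.q p.dom
  α_le : p.α ≤ θ
  condition : ∀ x ∈ p.safeSet,
    -p.α * p.h x ≤
      sSup ((fun u => p.Lf p.h x + p.Lg p.h x u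
        - p.rlow⁻¹ * p.phigh * Kh * (Kq : ℝ) ^ 2 * M₀) '' p.U)

/-- `A = ∂f/∂x(x̂) + ∂g/∂x(x̂) u`. -/
noncomputable def A (xh : Vec nx) (u : Vec nu) : Mat nx nx :=
  fderiv ℝ p.f xh + fderiv ℝ (fun x => p.g x u) xh

/-- `C = ∂q/∂x(x̂)`. -/
noncomputable def C (xh : Vec nx) : Mat nz nx := fderiv ℝ p.q xh

/-- Observer gain `S⁻¹ Cᵀ R⁻¹`. -/
noncomputable def gain (S : Mat nx nx) (xh : Vec nx) : Mat nx nz :=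
  minv S ∘L transp (p.C xh) ∘L minv p.R

/-- Right-hand side of the Riccati equation of the uncertainty,
`κ P + A P + P Aᵀ - P Cᵀ R⁻¹ C P + Q`. -/
noncomputable def riccati (P : Mat nx nx) (xh : Vec nx) (u : Vec nu) : Mat nx nx :=
  p.κ • P + p.A xh u ∘L P + P ∘L transp (p.A xh u)
    - P ∘L transp (p.C xh) ∘L minv p.R ∘L p.C xh ∘L P + p.Q

/-- First-order prediction of the confidence `S(t + Δt)`,
`S + Δt (-κ S - Aᵀ S - S A + Cᵀ R⁻¹ C - S Q S)`. -/
noncomputable def predict (S : Mat nx nx) (xh : Vec nx) (u : Vec nu) : Mat nx nx :=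
  S + p.Δt • (-(p.κ • S) - transp (p.A xh u) ∘L S - S ∘L p.A xh u
    + transp (p.C xh) ∘L minv p.R ∘L p.C xh - S ∘L p.Q ∘L S)

/-- Constraints of the program: the relaxed CLF inequality and the hard CBF inequality. -/
def Feasible (S : Mat nx nx) (xh : Vec nx) (z : Vec nz) (u : Vec nu) (δ : ℝ) : Prop :=
  p.Lf p.V xh + p.Lg p.V xh u + p.γ * p.V xh ≤ δ ∧
  0 ≤ p.Lf p.h xh + p.Lg p.h xh u + p.α * p.h xh
    + fderiv ℝ p.h xh (p.gain S xh (z - p.q xh))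

/-- Objective `uᵀu - c₁ λ_min(S(t + Δt)) + c₂ δ²`. -/
noncomputable def cost (S : Mat nx nx) (xh : Vec nx) (u : Vec nu) (δ : ℝ) : ℝ :=
  ⟪u, u⟫_ℝ - p.c₁ * lambdaMin (p.predict S xh u) + p.c₂ * δ ^ 2

/-- `(u, δ)` is a global minimizer of the program. -/
def IsMinimizer (S : Mat nx nx) (xh : Vec nx) (z : Vec nz) (u : Vec nu) (δ : ℝ) : Prop :=
  p.Feasible S xh z u δ ∧
  ∀ (u' : Vec nu) (δ' : ℝ), p.Feasible S xh z u' δ' → p.cost S xh u δ ≤ p.cost S xh u' δ'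

/-- Uniform bounds `p̲ I ≤ P(t) ≤ p̄ I` in the order of symmetric matrices (so that `P(t)` is
symmetric). -/
def UniformBounds (I : Set ℝ) (P : ℝ → Mat nx nx) : Prop :=
  ∀ t ∈ I, p.plow • (1 : Mat nx nx) ≤ P t ∧ P t ≤ p.phigh • (1 : Mat nx nx)

/-- The controller `π` is given by the program, the confidence being `S(t) = P(t)⁻¹`. -/
def IsProgramController (I : Set ℝ) (P : ℝ → Mat nx nx)
    (π : ℝ → Vec nx → Vec nz → Vec nu) : Prop :=
  ∀ t ∈ I, ∀ xh ∈ p.Xhat, ∀ z : Vec nz, ∃ δ : ℝ, p.IsMinimizer (minv (P t)) xh z (π t xh z) δ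

/-- Distinct eigenvalues of the confidence at the times in `J`: both `S(t)` and the matrix
`S(t + Δt)` that the program predicts for its optimal input have distinct eigenvalues, for estimates
in `𝒳̂` and outputs in `Z`. -/
def DistinctConfidence (J : Set ℝ) (Z : Set (Vec nz)) (P : ℝ → Mat nx nx)
    (π : ℝ → Vec nx → Vec nz → Vec nu) : Prop :=
  ∀ t ∈ J, DistinctEigenvalues (minv (P t)) ∧
    ∀ xh ∈ p.Xhat, ∀ z ∈ Z, DistinctEigenvalues (p.predict (minv (P t)) xh (π t xh z))

/-- `(x, x̂, P)` is a solution on `I` of plant, observer and Riccati equation in closed loop with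
the controller `π`. -/
structure ClosedLoop (I : Set ℝ) (P : ℝ → Mat nx nx) (π : ℝ → Vec nx → Vec nz → Vec nu)
    (x xh : ℝ → Vec nx) : Prop where
  state_mem : ∀ t ∈ I, x t ∈ p.X
  estimate_mem : ∀ t ∈ I, xh t ∈ p.Xhat
  plant : ∀ t ∈ I,
    HasDerivWithinAt x (p.f (x t) + p.g (x t) (π t (xh t) (p.q (x t)))) I t
  observer : ∀ t ∈ I,
    HasDerivWithinAt xh (p.f (xh t) + p.g (xh t) (π t (xh t) (p.q (x t)))
      + p.gain (minv (P t)) (xh t) (p.q (x t) - p.q (xh t))) I t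
  uncertainty : ∀ t ∈ I,
    HasDerivWithinAt P (p.riccati (P t) (xh t) (π t (xh t) (p.q (x t)))) I t

end Problem

/-- Local exponential bound on the estimation error `ζ = x - x̂` of a solution: if `‖ζ(0)‖ < ε`, then
`‖ζ(t)‖ ≤ η ‖ζ(0)‖ exp (-θ t)`. -/
def ErrorBound {nx : ℕ} (I : Set ℝ) (ε η θ : ℝ) (x xh : ℝ → Vec nx) : Prop :=
  ‖x 0 - xh 0‖ < ε → ∀ t ∈ I, ‖x t - xh t‖ ≤ η * ‖x 0 - xh 0‖ * Real.exp (-θ * t)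

/-!
The relaxation enters the program only through its positive part, and for symmetric matrices
`lambdaMin` is the smallest value `rayMin` of the quadratic form on the unit sphere, which is
concave in the matrix. Hence the program is the minimization of a strongly convex function of the
input `u` over one half-space, with data (`ProgData`) that are `C¹` functions of uncertainty,
estimate and output (`Problem.contDiffOn_data`). Relative degree one makes the half-space nonempty
and nondegenerate. So there is one solution (`ProgData.exists_isSol`, `ProgData.IsSol.unique`), and
it depends continuously on the data (`ProgData.continuousAt_sol`). Piecewise continuity in time
follows.

The Lipschitz property needs more than convexity, which alone would give Hölder continuity with
exponent `1/2`. On a compact set of symmetric matrices with simple eigenvalues the gap above the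
smallest eigenvalue has a positive lower bound (`exists_hasGap`). A gap makes the minimizing
eigenvector Lipschitz in the matrix (`HasGap.mul_norm_sub_le`), so that `rayMin` is differentiable
with Lipschitz derivative and the solution satisfies the Karush-Kuhn-Tucker conditions
(`ProgData.exists_multiplier`). The difference of these conditions for two programs, tested with the
difference `Δ` of the solutions, gives `2 ‖Δ‖² ≤ C d (d + ‖Δ‖)` for data at distance `d`
(`ProgData.exists_lipschitz`): the spectral term, the hinge term of the relaxation and the
multiplier term are all monotone up to errors of this size.

For the error bound, the function `⟪P⁻¹ ζ, ζ⟫` of the error `ζ` decays along solutions at a rate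
larger than `κ`, up to a cubic term: in its derivative the terms with `A` cancel against the Riccati
equation (`Problem.lyapunov_rate_eq`), the weight `Q` supplies the additional decay, and the
linearization errors are quadratic in `ζ` uniformly on the compact sets
(`exists_linearization_bound`), because the controller is bounded there. A comparison argument
(`le_mul_exp_of_deriv_lt`) keeps the error in the region where the cubic term is dominated.

For safety, the hard constraint of the program says that `h` decreases along the estimate at rate
at most `α`, and `h` at the state differs from `h` at the estimate by at most `Kh` times the error,
which decays at rate `θ ≥ α`.
-/

/-! ### Smallest value of a quadratic form on the unit sphere -/

section RayleighMin

variable {H : Type*} [NormedAddCommGroup H] [InnerProductSpace ℝ H]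

/-- Smallest value of `⟪M v, v⟫` on the unit sphere. For symmetric `M` it is the smallest
eigenvalue; it is Lipschitz and concave in `M` even without symmetry. -/
noncomputable def rayMin (M : H →L[ℝ] H) : ℝ :=
  sInf ((fun v => ⟪M v, v⟫_ℝ) '' Metric.sphere 0 1)

/-- `M` has a gap of size `g` above its smallest value `rayMin M`: in the directions orthogonal to
a minimizing vector, the quadratic form is at least `rayMin M + g`. -/
def HasGap (M : H →L[ℝ] H) (g : ℝ) : Prop :=
  ∀ v w : H, ‖v‖ = 1 → ⟪M v, v⟫_ℝ = rayMin M →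
    rayMin M * ‖w‖ ^ 2 + g * (‖w‖ ^ 2 - ⟪w, v⟫_ℝ ^ 2) ≤ ⟪M w, w⟫_ℝ

theorem abs_inner_apply_le (M : H →L[ℝ] H) (v w : H) : |⟪M v, w⟫_ℝ| ≤ ‖M‖ * ‖v‖ * ‖w‖ :=
  (abs_real_inner_le_norm _ _).trans (by gcongr; exact M.le_opNorm v)

theorem rayMin_le (M : H →L[ℝ] H) {v : H} (hv : ‖v‖ = 1) :
    rayMin M ≤ ⟪M v, v⟫_ℝ := by
  refine csInf_le ⟨-‖M‖, ?_⟩ ⟨v, by simpa using hv, rfl⟩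
  rintro _ ⟨w, hw, rfl⟩
  have hw : ‖w‖ = 1 := by simpa using hw
  have := abs_inner_apply_le M w w
  rw [hw] at this
  have := neg_le_of_abs_le this
  simpa using this

theorem rayMin_mul_sq_le (M : H →L[ℝ] H) (w : H) : rayMin M * ‖w‖ ^ 2 ≤ ⟪M w, w⟫_ℝ := by
  rcases eq_or_ne w 0 with rfl | hw
  · simp
  have hw' : ‖w‖ ≠ 0 := norm_ne_zero_iff.2 hw
  have h := rayMin_le M (v := ‖w‖⁻¹ • w) (by rw [norm_smul, norm_inv, norm_norm, inv_mul_cancel₀ hw'])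
  rw [map_smul, real_inner_smul_left, real_inner_smul_right] at h
  calc rayMin M * ‖w‖ ^ 2 ≤ ‖w‖⁻¹ * (‖w‖⁻¹ * ⟪M w, w⟫_ℝ) * ‖w‖ ^ 2 := by gcongr
    _ = ⟪M w, w⟫_ℝ := by field_simp

theorem apply_eq_rayMin_smul [CompleteSpace H] {M : H →L[ℝ] H} (hM : IsSelfAdjoint M) {v : H} (hv : ‖v‖ = 1)
    (h : ⟪M v, v⟫_ℝ = rayMin M) : M v = rayMin M • v := by
  have hmin : IsMinOn M.reApplyInnerSelf (Metric.sphere 0 ‖v‖) v := by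
    intro w hw
    have hw : ‖w‖ = 1 := by simpa [hv] using hw
    show M.reApplyInnerSelf v ≤ M.reApplyInnerSelf w
    simp only [ContinuousLinearMap.reApplyInnerSelf_apply, RCLike.re_to_real]
    rw [h]
    exact rayMin_le M hw
  have hv0 : v ≠ 0 := by rintro rfl; simp at hv
  have h2 := hM.eq_smul_self_of_isLocalExtrOn (x₀ := v) (Or.inl hmin.localize)
  rw [h2]
  simp [ContinuousLinearMap.rayleighQuotient, ContinuousLinearMap.reApplyInnerSelf_apply, hv, h]

/-- Minimizing unit vectors, with matching signs, are Lipschitz in the matrix; the gap is needed at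
one of the two matrices only. -/
theorem HasGap.mul_norm_sub_le {M N : H →L[ℝ] H} {g : ℝ} (hg : 0 < g) (hM : HasGap M g) {v w : H}
    (hv : ‖v‖ = 1) (hw : ‖w‖ = 1) (hvM : ⟪M v, v⟫_ℝ = rayMin M) (hwN : ⟪N w, w⟫_ℝ = rayMin N)
    (hvw : 0 ≤ ⟪w, v⟫_ℝ) : g * ‖w - v‖ ≤ 4 * ‖M - N‖ := by
  have h1 := hM v w hv hvM
  have h2 := rayMin_le N hv
  have hc : ⟪w, v⟫_ℝ ≤ 1 := by simpa [hv, hw] using real_inner_le_norm w v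
  have hd : ‖w - v‖ ^ 2 = 2 - 2 * ⟪w, v⟫_ℝ := by
    rw [norm_sub_sq_real, hv, hw]; ring
  have hs : ‖w + v‖ ≤ 2 := (norm_add_le _ _).trans (by rw [hv, hw]; norm_num)
  -- minimality of `v` for `M` and of `w` for `N` leaves only the increment of the form `M - N`
  have h3 : ⟪(M - N) w, w⟫_ℝ - ⟪(M - N) v, v⟫_ℝ
      = (⟪(M - N) (w - v), w + v⟫_ℝ + ⟪(M - N) (w + v), w - v⟫_ℝ) / 2 := by
    simp only [map_sub, map_add, inner_sub_left, inner_add_left, inner_sub_right, inner_add_right]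
    ring
  have h4 := (le_abs_self _).trans (abs_inner_apply_le (M - N) (w - v) (w + v))
  have h5 := (le_abs_self _).trans (abs_inner_apply_le (M - N) (w + v) (w - v))
  have h6 : ‖M - N‖ * ‖w - v‖ * ‖w + v‖ ≤ ‖M - N‖ * ‖w - v‖ * 2 := by gcongr
  have h9 : ⟪(M - N) w, w⟫_ℝ - ⟪(M - N) v, v⟫_ℝ
      = ⟪M w, w⟫_ℝ - ⟪N w, w⟫_ℝ - (⟪M v, v⟫_ℝ - ⟪N v, v⟫_ℝ) := by
    simp only [sub_apply, inner_sub_left]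
  rw [hw] at h1
  have h7 : g * (‖w - v‖ ^ 2 / 2) ≤ g * (1 ^ 2 - ⟪w, v⟫_ℝ ^ 2) := by
    gcongr
    nlinarith
  have h8 : ‖w - v‖ * (g * ‖w - v‖) ≤ ‖w - v‖ * (4 * ‖M - N‖) := by
    linarith
  rcases (norm_nonneg (w - v)).eq_or_lt with h0 | h0
  · rw [← h0]; simp
  · exact le_of_mul_le_mul_left h8 h0

variable [FiniteDimensional ℝ H] [Nontrivial H]

theorem exists_eq_rayMin (M : H →L[ℝ] H) : ∃ v : H, ‖v‖ = 1 ∧ ⟪M v, v⟫_ℝ = rayMin M := by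
  have hc : IsCompact ((fun v : H => ⟪M v, v⟫_ℝ) '' Metric.sphere 0 1) :=
    (isCompact_sphere 0 1).image (by fun_prop)
  obtain ⟨v, hv, h⟩ := hc.sInf_mem ((NormedSpace.sphere_nonempty.2 zero_le_one).image _)
  exact ⟨v, by simpa using hv, h⟩

theorem rayMin_le_add_norm_sub (M N : H →L[ℝ] H) : rayMin M ≤ rayMin N + ‖M - N‖ := by
  obtain ⟨v, hv, h⟩ := exists_eq_rayMin N
  have h1 := rayMin_le M hv
  have h2 := (le_abs_self _).trans (abs_inner_apply_le (M - N) v v)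
  rw [sub_apply, inner_sub_left, hv] at h2
  linarith

theorem abs_rayMin_sub_le (M N : H →L[ℝ] H) : |rayMin M - rayMin N| ≤ ‖M - N‖ := by
  have h1 := rayMin_le_add_norm_sub M N
  have h2 := rayMin_le_add_norm_sub N M
  rw [norm_sub_rev] at h2
  exact abs_le.2 ⟨by linarith, by linarith⟩

theorem abs_rayMin_le (M : H →L[ℝ] H) : |rayMin M| ≤ ‖M‖ := by
  obtain ⟨v, hv, h⟩ := exists_eq_rayMin M
  have := abs_inner_apply_le M v v
  rwa [h, hv, mul_one, mul_one] at this

theorem continuous_rayMin : Continuous (rayMin : (H →L[ℝ] H) → ℝ) := by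
  refine (LipschitzWith.of_dist_le_mul (K := 1) fun M N => ?_).continuous
  rw [Real.dist_eq, dist_eq_norm, NNReal.coe_one, one_mul]
  exact abs_rayMin_sub_le M N

theorem rayMin_add_rayMin_le {M M' N : H →L[ℝ] H} (h : M + M' = (2 : ℝ) • N) :
    rayMin M + rayMin M' ≤ 2 * rayMin N := by
  obtain ⟨v, hv, hN⟩ := exists_eq_rayMin N
  have h1 := rayMin_le M hv
  have h2 := rayMin_le M' hv
  have h3 : ⟪(M + M') v, v⟫_ℝ = ⟪((2 : ℝ) • N) v, v⟫_ℝ := by rw [h]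
  rw [add_apply, smul_apply, inner_add_left,
    real_inner_smul_left, hN] at h3
  linarith

/-- Along a line that starts at a matrix with a gap, `rayMin` is its linearization up to a
quadratic error. The linear term is an upper bound by concavity. -/
theorem HasGap.le_rayMin_add {M : H →L[ℝ] H} {g : ℝ} (hg : 0 < g) (hM : HasGap M g) {v : H}
    (hv : ‖v‖ = 1) (hvM : ⟪M v, v⟫_ℝ = rayMin M) (N : H →L[ℝ] H) :
    rayMin M + ⟪N v, v⟫_ℝ - 8 / g * ‖N‖ ^ 2 ≤ rayMin (M + N) := by
  obtain ⟨w, hw, hwN, hwv⟩ : ∃ w : H, ‖w‖ = 1 ∧ ⟪(M + N) w, w⟫_ℝ = rayMin (M + N) ∧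
      0 ≤ ⟪w, v⟫_ℝ := by
    obtain ⟨w, hw, hwN⟩ := exists_eq_rayMin (M + N)
    rcases le_total 0 ⟪w, v⟫_ℝ with h | h
    · exact ⟨w, hw, hwN, h⟩
    · exact ⟨-w, by rwa [norm_neg], by rwa [map_neg, inner_neg_neg], by
        rw [inner_neg_left]; linarith⟩
  have h1 := hM.mul_norm_sub_le hg hv hw hvM hwN hwv
  rw [sub_add_cancel_left, norm_neg] at h1
  have h2 := rayMin_le M hw
  have h3 : ⟪N v, v⟫_ℝ - ⟪N w, w⟫_ℝ
      = -(⟪N (w - v), w⟫_ℝ + ⟪N v, w - v⟫_ℝ) := by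
    simp only [map_sub, inner_sub_left, inner_sub_right]
    ring
  have h4 := (neg_le_abs _).trans (abs_inner_apply_le N (w - v) w)
  have h5 := (neg_le_abs _).trans (abs_inner_apply_le N v (w - v))
  have h6 : ‖w - v‖ ≤ 4 * ‖N‖ / g := by rw [le_div_iff₀ hg]; linarith
  have h7 : ‖N‖ * ‖w - v‖ ≤ ‖N‖ * (4 * ‖N‖ / g) := by gcongr
  have h8 : ‖N‖ * (4 * ‖N‖ / g) * 2 = 8 / g * ‖N‖ ^ 2 := by ring
  rw [add_apply, inner_add_left] at hwN
  rw [hw, mul_one] at h4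
  rw [hv, mul_one] at h5
  linarith

/-- On a compact set of symmetric matrices with simple eigenvalues, the gap is bounded below. -/
theorem exists_hasGap [CompleteSpace H] {K : Set (H →L[ℝ] H)} (hK : IsCompact K)
    (hsa : ∀ M ∈ K, IsSelfAdjoint M)
    (hsimple : ∀ M ∈ K, ∀ μ : ℝ,
      Module.finrank ℝ (Module.End.eigenspace (M : H →ₗ[ℝ] H) μ) ≤ 1) :
    ∃ g > 0, ∀ M ∈ K, HasGap M g := by
  -- the sum of the form over an orthonormal pair exceeds twice the minimum
  let T : Set ((H →L[ℝ] H) × H × H) :=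
    (K ×ˢ Metric.sphere (0 : H) 1 ×ˢ Metric.sphere (0 : H) 1) ∩ {y | ⟪y.2.2, y.2.1⟫_ℝ = 0}
  let φ : (H →L[ℝ] H) × H × H → ℝ := fun y =>
    ⟪y.1 y.2.1, y.2.1⟫_ℝ + ⟪y.1 y.2.2, y.2.2⟫_ℝ - 2 * rayMin y.1
  have hT : IsCompact T := (hK.prod ((isCompact_sphere 0 1).prod (isCompact_sphere 0 1))).inter_right
    (isClosed_eq (by fun_prop) continuous_const)
  have hφ : Continuous φ := by
    have := (continuous_rayMin (H := H)).comp (continuous_fst (X := H →L[ℝ] H) (Y := H × H))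
    simp only [Function.comp_def] at this
    fun_prop
  have hpos : ∀ y ∈ T, 0 < φ y := by
    rintro ⟨M, v, w⟩ ⟨⟨hM, hv, hw⟩, hvw⟩
    simp only [mem_sphere_iff_norm, sub_zero, mem_ofPred_eq] at hM hv hw hvw
    have h1 := rayMin_le M hv
    have h2 := rayMin_le M hw
    by_contra hcon
    have hcon : ⟪M v, v⟫_ℝ + ⟪M w, w⟫_ℝ - 2 * rayMin M ≤ 0 := not_lt.1 hcon
    have hv' := apply_eq_rayMin_smul (hsa M hM) hv (by linarith)
    have hw' := apply_eq_rayMin_smul (hsa M hM) hw (by linarith)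
    obtain ⟨c, hc⟩ := finrank_le_one_iff.1 (hsimple M hM (rayMin M))
    obtain ⟨a, ha⟩ := hc ⟨v, Module.End.mem_eigenspace_iff.2 hv'⟩
    obtain ⟨b, hb⟩ := hc ⟨w, Module.End.mem_eigenspace_iff.2 hw'⟩
    have ha : a • (c : H) = v := congrArg Subtype.val ha
    have hb : b • (c : H) = w := congrArg Subtype.val hb
    have ha0 : a ≠ 0 := by rintro rfl; rw [zero_smul] at ha; rw [← ha] at hv; simp at hv
    have hb0 : b ≠ 0 := by rintro rfl; rw [zero_smul] at hb; rw [← hb] at hw; simp at hw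
    rw [← ha, ← hb, real_inner_smul_left, real_inner_smul_right] at hvw
    have : (c : H) = 0 := by simpa [ha0, hb0] using hvw
    rw [this, smul_zero] at ha
    rw [← ha] at hv
    simp at hv
  obtain ⟨g, hg, hgT⟩ : ∃ g > 0, ∀ y ∈ T, g ≤ φ y := by
    rcases T.eq_empty_or_nonempty with h | h
    · exact ⟨1, one_pos, by simp [h]⟩
    · obtain ⟨y, hy, hmin⟩ := hT.exists_isMinOn h hφ.continuousOn
      exact ⟨φ y, hpos y hy, fun z hz => hmin hz⟩
  refine ⟨g, hg, fun M hM v w hv hvM => ?_⟩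
  have hev := apply_eq_rayMin_smul (hsa M hM) hv hvM
  have hsym : ∀ x, ⟪M x, v⟫_ℝ = rayMin M * ⟪x, v⟫_ℝ := fun x => by
    have h : ⟪M x, v⟫_ℝ = ⟪x, M v⟫_ℝ := (hsa M hM).isSymmetric x v
    rw [h, hev, real_inner_smul_right]
  set c := ⟪w, v⟫_ℝ with hc
  set r := w - c • v with hr
  have hrv : ⟪r, v⟫_ℝ = 0 := by
    rw [hr, inner_sub_left, real_inner_smul_left, real_inner_self_eq_norm_sq, hv]; simp [hc]
  have hw : w = c • v + r := by rw [hr]; abel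
  have hnorm : ‖w‖ ^ 2 = c ^ 2 + ‖r‖ ^ 2 := by
    rw [hw, norm_add_sq_real, real_inner_smul_left, real_inner_comm, hrv, norm_smul, hv]; simp
  have hform : ⟪M w, w⟫_ℝ = rayMin M * c ^ 2 + ⟪M r, r⟫_ℝ := by
    rw [hw, map_add, map_smul, hev]
    simp only [inner_add_left, inner_add_right, real_inner_smul_left, real_inner_smul_right, hsym,
      hrv, real_inner_comm r v, real_inner_self_eq_norm_sq, hv]
    ring
  have hrr : (rayMin M + g) * ‖r‖ ^ 2 ≤ ⟪M r, r⟫_ℝ := by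
    rcases eq_or_ne r 0 with h0 | h0
    · simp [h0]
    have h0' : ‖r‖ ≠ 0 := norm_ne_zero_iff.2 h0
    have h := hgT (M, v, ‖r‖⁻¹ • r) ⟨⟨hM, by simpa using hv, by
      simp [norm_smul, h0']⟩, by
      simp [real_inner_smul_left, hrv]⟩
    simp only [φ, map_smul, real_inner_smul_left, real_inner_smul_right] at h
    have h' : rayMin M + g ≤ ‖r‖⁻¹ * (‖r‖⁻¹ * ⟪M r, r⟫_ℝ) := by linarith
    calc (rayMin M + g) * ‖r‖ ^ 2 ≤ ‖r‖⁻¹ * (‖r‖⁻¹ * ⟪M r, r⟫_ℝ) * ‖r‖ ^ 2 := by gcongr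
      _ = ⟪M r, r⟫_ℝ := by field_simp
  rw [hform, hnorm]
  linarith

end RayleighMin

theorem lambdaMin_eq_rayMin {n : ℕ} [NeZero n] {M : Mat n n} (hM : IsSelfAdjoint M) :
    lambdaMin M = rayMin M := by
  refine IsLeast.csInf_eq ⟨?_, ?_⟩
  · obtain ⟨v, hv, h⟩ := exists_eq_rayMin M
    refine Module.End.hasEigenvalue_of_hasEigenvector (x := v)
      (Module.End.hasEigenvector_iff.2 ⟨Module.End.mem_eigenspace_iff.2 ?_, ?_⟩)
    · exact apply_eq_rayMin_smul hM hv h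
    · rintro rfl; simp at hv
  · intro μ hμ
    obtain ⟨v, hv⟩ := Module.End.HasEigenvalue.exists_hasEigenvector hμ
    have h1 : M v = μ • v := hv.apply_eq_smul
    have h2 := rayMin_mul_sq_le M v
    rw [h1, real_inner_smul_left, real_inner_self_eq_norm_sq] at h2
    exact le_of_mul_le_mul_right h2 (by have := norm_pos_iff.2 hv.2; positivity)

/-! ### The program with affine data -/

/-- Data `(a, b, e, k, M₀, Λ)` of the program in the input `u` alone: the constraint `a u + b ≥ 0`,
the affine function `e u + k` whose positive part is the optimal relaxation, and the
matrix `M₀ + Λ u`. A nested product, so that it carries the norm of a product. -/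
abbrev ProgData (U H : Type*) [NormedAddCommGroup U] [InnerProductSpace ℝ U]
    [NormedAddCommGroup H] [InnerProductSpace ℝ H] : Type _ :=
  (U →L[ℝ] ℝ) × ℝ × (U →L[ℝ] ℝ) × ℝ × (H →L[ℝ] H) × (U →L[ℝ] H →L[ℝ] H)

namespace ProgData

variable {U H : Type*} [NormedAddCommGroup U] [InnerProductSpace ℝ U]
    [NormedAddCommGroup H] [InnerProductSpace ℝ H]

/-- Left-hand side `a u + b` of the hard constraint. -/
noncomputable def barrier (θ : ProgData U H) (u : U) : ℝ := θ.1 u + θ.2.1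

/-- The affine function `e u + k` of the relaxed constraint. -/
noncomputable def lyap (θ : ProgData U H) (u : U) : ℝ := θ.2.2.1 u + θ.2.2.2.1

/-- The matrix `M₀ + Λ u`. -/
noncomputable def mat (θ : ProgData U H) (u : U) : H →L[ℝ] H := θ.2.2.2.2.1 + θ.2.2.2.2.2 u

/-- Objective after minimization over the relaxation variable. -/
noncomputable def obj (c₁ c₂ : ℝ) (θ : ProgData U H) (u : U) : ℝ :=
  ⟪u, u⟫_ℝ - c₁ * rayMin (θ.mat u) + c₂ * (max 0 (θ.lyap u)) ^ 2

/-- `u` solves the program with data `θ`. -/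
def IsSol (c₁ c₂ : ℝ) (θ : ProgData U H) (u : U) : Prop :=
  0 ≤ θ.barrier u ∧ ∀ w, 0 ≤ θ.barrier w → obj c₁ c₂ θ u ≤ obj c₁ c₂ θ w

/-- The solution of the program (an arbitrary vector if there is none). -/
noncomputable def sol (c₁ c₂ : ℝ) (θ : ProgData U H) : U := Classical.epsilon (IsSol c₁ c₂ θ)

theorem continuous_barrier : Continuous fun y : ProgData U H × U => y.1.barrier y.2 := by
  unfold barrier; fun_prop

theorem continuous_lyap : Continuous fun y : ProgData U H × U => y.1.lyap y.2 := by
  unfold lyap; fun_prop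

theorem continuous_mat : Continuous fun y : ProgData U H × U => y.1.mat y.2 := by
  unfold mat; fun_prop

theorem norm_barrierRow_le (θ : ProgData U H) : ‖θ.1‖ ≤ ‖θ‖ := norm_fst_le θ

theorem norm_barrierConst_le (θ : ProgData U H) : ‖θ.2.1‖ ≤ ‖θ‖ :=
  (norm_fst_le _).trans (norm_snd_le θ)

theorem norm_lyapRow_le (θ : ProgData U H) : ‖θ.2.2.1‖ ≤ ‖θ‖ :=
  (norm_fst_le _).trans ((norm_snd_le _).trans (norm_snd_le θ))

theorem norm_lyapConst_le (θ : ProgData U H) : ‖θ.2.2.2.1‖ ≤ ‖θ‖ :=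
  (norm_fst_le _).trans ((norm_snd_le _).trans ((norm_snd_le _).trans (norm_snd_le θ)))

theorem norm_matConst_le (θ : ProgData U H) : ‖θ.2.2.2.2.1‖ ≤ ‖θ‖ :=
  (norm_fst_le _).trans ((norm_snd_le _).trans ((norm_snd_le _).trans
    ((norm_snd_le _).trans (norm_snd_le θ))))

theorem norm_matRow_le (θ : ProgData U H) : ‖θ.2.2.2.2.2‖ ≤ ‖θ‖ :=
  (norm_snd_le _).trans ((norm_snd_le _).trans ((norm_snd_le _).trans
    ((norm_snd_le _).trans (norm_snd_le θ))))

theorem norm_mat_le (θ : ProgData U H) (u : U) : ‖θ.mat u‖ ≤ ‖θ‖ + ‖θ‖ * ‖u‖ :=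
  (norm_add_le _ _).trans (add_le_add θ.norm_matConst_le
    ((ContinuousLinearMap.le_opNorm _ _).trans (by gcongr; exact θ.norm_matRow_le)))

theorem barrier_midpoint (θ : ProgData U H) (u w : U) :
    θ.barrier ((1 / 2 : ℝ) • (u + w)) = (θ.barrier u + θ.barrier w) / 2 := by
  simp only [barrier, map_smul, map_add, smul_eq_mul]; ring

theorem lyap_midpoint (θ : ProgData U H) (u w : U) :
    θ.lyap ((1 / 2 : ℝ) • (u + w)) = (θ.lyap u + θ.lyap w) / 2 := by
  simp only [lyap, map_smul, map_add, smul_eq_mul]; ring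

theorem mat_midpoint (θ : ProgData U H) (u w : U) :
    θ.mat u + θ.mat w = (2 : ℝ) • θ.mat ((1 / 2 : ℝ) • (u + w)) := by
  simp only [mat, map_smul, map_add, smul_add, smul_smul]
  norm_num
  rw [two_smul]
  abel

theorem exists_barrier_pos {θ : ProgData U H} (ha : θ.1 ≠ 0) : ∃ w, 0 < θ.barrier w := by
  obtain ⟨d, hd⟩ : ∃ d, θ.1 d ≠ 0 := by
    by_contra! h
    exact ha (ContinuousLinearMap.ext h)
  refine ⟨((1 - θ.2.1) / θ.1 d) • d, ?_⟩
  rw [barrier, map_smul, smul_eq_mul, div_mul_cancel₀ _ hd]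
  norm_num

variable {c₁ c₂ : ℝ}

section Existence

variable [FiniteDimensional ℝ H] [Nontrivial H]

theorem continuous_obj : Continuous fun y : ProgData U H × U => obj c₁ c₂ y.1 y.2 := by
  have h1 := (continuous_rayMin (H := H)).comp (continuous_mat (U := U))
  have h2 := continuous_lyap (U := U) (H := H)
  simp only [Function.comp_def] at h1
  unfold obj
  fun_prop

theorem norm_le_of_obj_le (hc₁ : 0 ≤ c₁) (hc₂ : 0 ≤ c₂) {θ : ProgData U H} {u : U} {B C : ℝ}
    (hθ : ‖θ‖ ≤ B) (hu : obj c₁ c₂ θ u ≤ C) : ‖u‖ ≤ |C| + 2 * (c₁ * B) + 1 := by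
  have h1 := (le_abs_self _).trans ((abs_rayMin_le (θ.mat u)).trans (θ.norm_mat_le u))
  have hB : 0 ≤ B := (norm_nonneg θ).trans hθ
  have h2 : ‖θ‖ + ‖θ‖ * ‖u‖ ≤ B + B * ‖u‖ := by gcongr
  have h3 : c₁ * rayMin (θ.mat u) ≤ c₁ * (B + B * ‖u‖) := by gcongr; linarith
  have h4 : 0 ≤ c₂ * (max 0 (θ.lyap u)) ^ 2 := by positivity
  rw [obj, real_inner_self_eq_norm_sq] at hu
  have h5 := le_abs_self C
  have h6 : 0 ≤ c₁ * B := by positivity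
  by_contra! h
  have h7 : 0 < ‖u‖ - 1 := by have := abs_nonneg C; linarith
  nlinarith [abs_nonneg C, mul_nonneg h6 (norm_nonneg u), mul_pos h7 h7]

theorem IsSol.unique (hc₁ : 0 ≤ c₁) (hc₂ : 0 ≤ c₂) {θ : ProgData U H} {u w : U}
    (hu : IsSol c₁ c₂ θ u) (hw : IsSol c₁ c₂ θ w) : u = w := by
  have hm : 0 ≤ θ.barrier ((1 / 2 : ℝ) • (u + w)) := by
    rw [barrier_midpoint]; have := hu.1; have := hw.1; positivity
  have h1 := hu.2 _ hm
  have h2 := hw.2 _ hm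
  have h3 := rayMin_add_rayMin_le (θ.mat_midpoint u w)
  have h4 : (max 0 (θ.lyap ((1 / 2 : ℝ) • (u + w)))) ^ 2
      ≤ ((max 0 (θ.lyap u) + max 0 (θ.lyap w)) / 2) ^ 2 := by
    rw [lyap_midpoint]
    refine pow_le_pow_left₀ (le_max_left _ _) (max_le (by positivity) ?_) 2
    have := le_max_right 0 (θ.lyap u)
    have := le_max_right 0 (θ.lyap w)
    linarith
  have h5 : ⟪(1 / 2 : ℝ) • (u + w), (1 / 2 : ℝ) • (u + w)⟫_ℝ
      = (⟪u, u⟫_ℝ + ⟪w, w⟫_ℝ) / 2 - ‖u - w‖ ^ 2 / 4 := by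
    rw [← real_inner_self_eq_norm_sq]
    simp only [real_inner_smul_left, real_inner_smul_right, inner_add_left, inner_add_right,
      inner_sub_left, inner_sub_right]
    ring
  simp only [obj] at h1 h2
  rw [h5] at h1 h2
  have h6 := mul_le_mul_of_nonneg_left h3 hc₁
  have h7 := mul_le_mul_of_nonneg_left h4 hc₂
  have h8 := mul_nonneg hc₂ (sq_nonneg (max 0 (θ.lyap u) - max 0 (θ.lyap w)))
  have h9 : ‖u - w‖ ^ 2 ≤ 0 := by nlinarith
  exact sub_eq_zero.1 (norm_eq_zero.1 (pow_eq_zero_iff two_ne_zero |>.1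
    (le_antisymm h9 (sq_nonneg _))))

variable [FiniteDimensional ℝ U]

theorem exists_isSol (hc₁ : 0 ≤ c₁) (hc₂ : 0 ≤ c₂) {θ : ProgData U H} (ha : θ.1 ≠ 0) :
    ∃ u, IsSol c₁ c₂ θ u := by
  obtain ⟨w, hw⟩ := exists_barrier_pos ha
  have hb : Continuous θ.barrier := continuous_barrier.comp (Continuous.prodMk_right θ)
  have ho : Continuous (obj c₁ c₂ θ) := continuous_obj.comp (Continuous.prodMk_right θ)
  obtain ⟨u, hu, hmin⟩ := ho.continuousOn.exists_isMinOn' (s := {u | 0 ≤ θ.barrier u})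
    (isClosed_le continuous_const hb) hw.le (by
      refine Filter.Eventually.filter_mono inf_le_left ?_
      have := (isCompact_closedBall (0 : U)
        (|obj c₁ c₂ θ w| + 2 * (c₁ * ‖θ‖) + 1)).compl_mem_cocompact
      filter_upwards [this] with x hx
      by_contra! hcon
      exact hx (mem_closedBall_zero_iff.2 (norm_le_of_obj_le hc₁ hc₂ le_rfl hcon.le)))
  exact ⟨u, hu, fun x hx => hmin hx⟩

theorem isSol_sol (hc₁ : 0 ≤ c₁) (hc₂ : 0 ≤ c₂) {θ : ProgData U H} (ha : θ.1 ≠ 0) :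
    IsSol c₁ c₂ θ (sol c₁ c₂ θ) :=
  Classical.epsilon_spec (exists_isSol hc₁ hc₂ ha)

/-- A limit of solutions is feasible and at least as good as every strictly feasible point; these
are dense in the feasible set, so the limit is the solution for the limiting data. -/
theorem continuousAt_sol (hc₁ : 0 ≤ c₁) (hc₂ : 0 ≤ c₂) {θ : ProgData U H} (ha : θ.1 ≠ 0) :
    ContinuousAt (sol c₁ c₂) θ := by
  obtain ⟨w, hw⟩ := exists_barrier_pos ha
  have hne : ∀ᶠ θ' : ProgData U H in 𝓝 θ, θ'.1 ≠ 0 := continuous_fst.continuousAt.eventually_ne ha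
  have hsol : ∀ᶠ θ' in 𝓝 θ, IsSol c₁ c₂ θ' (sol c₁ c₂ θ') := by
    filter_upwards [hne] with θ' h using isSol_sol hc₁ hc₂ h
  have hbar : ∀ x, Continuous fun θ' : ProgData U H => θ'.barrier x := fun x =>
    continuous_barrier.comp (Continuous.prodMk_left x)
  have hobj : ∀ x, Continuous fun θ' : ProgData U H => obj c₁ c₂ θ' x := fun x =>
    continuous_obj.comp (Continuous.prodMk_left x)
  have hbdd : ∀ᶠ θ' in 𝓝 θ, sol c₁ c₂ θ' ∈ Metric.closedBall (0 : U)
      (|obj c₁ c₂ θ w + 1| + 2 * (c₁ * (‖θ‖ + 1)) + 1) := by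
    filter_upwards [hsol, (hbar w).continuousAt.eventually (lt_mem_nhds hw),
      (hobj w).continuousAt.eventually (gt_mem_nhds (lt_add_one _)),
      (continuous_norm (E := ProgData U H)).continuousAt.eventually
        (gt_mem_nhds (lt_add_one ‖θ‖))] with θ' h1 h2 h3 h4
    exact mem_closedBall_zero_iff.2
      (norm_le_of_obj_le hc₁ hc₂ h4.le ((h1.2 w h2.le).trans h3.le))
  refine (isCompact_closedBall _ _).tendsto_nhds_of_unique_mapClusterPt hbdd fun u _ hu => ?_
  refine IsSol.unique hc₁ hc₂ ?_ (isSol_sol hc₁ hc₂ ha)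
  obtain ⟨F, hF, hFu⟩ := mapClusterPt_iff_ultrafilter.1 hu
  have hpair : Tendsto (fun θ' => (θ', sol c₁ c₂ θ')) F (𝓝 (θ, u)) :=
    (tendsto_id'.2 hF).prodMk_nhds hFu
  have hstrict : ∀ x, 0 < θ.barrier x → obj c₁ c₂ θ u ≤ obj c₁ c₂ θ x := by
    intro x hx
    refine le_of_tendsto_of_tendsto ((continuous_obj.tendsto (θ, u)).comp hpair)
      (((hobj x).tendsto θ).mono_left hF) ?_
    filter_upwards [hF hsol, hF ((hbar x).continuousAt.eventually (lt_mem_nhds hx))] with θ' h1 h2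
    exact h1.2 x h2.le
  refine ⟨ge_of_tendsto ((continuous_barrier.tendsto (θ, u)).comp hpair) ?_, fun x hx => ?_⟩
  · filter_upwards [hF hsol] with θ' h using h.1
  · have hlim : Tendsto (fun s : ℝ => obj c₁ c₂ θ (x + s • (w - x))) (𝓝[>] 0)
        (𝓝 (obj c₁ c₂ θ x)) := by
      have hc : Continuous fun s : ℝ => obj c₁ c₂ θ (x + s • (w - x)) :=
        continuous_obj.comp (continuous_const.prodMk (by fun_prop))
      simpa using (hc.tendsto 0).mono_left nhdsWithin_le_nhds
    refine ge_of_tendsto hlim ?_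
    filter_upwards [Ioo_mem_nhdsGT (zero_lt_one (α := ℝ))] with s hs
    refine hstrict _ ?_
    have : θ.barrier (x + s • (w - x)) = (1 - s) * θ.barrier x + s * θ.barrier w := by
      simp only [barrier, map_add, map_smul, map_sub, smul_eq_mul]; ring
    rw [this]
    have h1 : 0 ≤ (1 - s) * θ.barrier x := mul_nonneg (by linarith [hs.2]) hx
    have h2 := mul_pos hs.1 hw
    linarith

end Existence

end ProgData

/-! ### Stationarity and Lipschitz dependence of the solution on the data -/

namespace ProgData

variable {U H : Type*} [NormedAddCommGroup U] [InnerProductSpace ℝ U]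
    [NormedAddCommGroup H] [InnerProductSpace ℝ H]
variable {c₁ c₂ : ℝ}

/-- Derivative of the objective at `u` in direction `d`, where `v` is a unit vector that minimizes
the quadratic form of `θ.mat u`. -/
noncomputable def slope (c₁ c₂ : ℝ) (θ : ProgData U H) (u : U) (v : H) (d : U) : ℝ :=
  2 * ⟪u, d⟫_ℝ - c₁ * ⟪θ.2.2.2.2.2 d v, v⟫_ℝ + 2 * c₂ * (max 0 (θ.lyap u) * θ.2.2.1 d)

theorem slope_add (θ : ProgData U H) (u : U) (v : H) (d d' : U) :
    slope c₁ c₂ θ u v (d + d') = slope c₁ c₂ θ u v d + slope c₁ c₂ θ u v d' := by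
  simp only [slope, map_add, add_apply, inner_add_left, inner_add_right]; ring

theorem slope_smul (θ : ProgData U H) (u : U) (v : H) (s : ℝ) (d : U) :
    slope c₁ c₂ θ u v (s • d) = s * slope c₁ c₂ θ u v d := by
  simp only [slope, map_smul, smul_apply, real_inner_smul_left, real_inner_smul_right, smul_eq_mul]
  ring

theorem mat_add_smul (θ : ProgData U H) (u d : U) (s : ℝ) :
    θ.mat (u + s • d) = θ.mat u + s • θ.2.2.2.2.2 d := by
  simp only [mat, map_add, map_smul]; abel

section Pair

variable {θ₁ θ₂ : ProgData U H} {u₁ u₂ : U} {B : ℝ}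

theorem abs_mul_sub_mul_le {ν₁ ν₂ x₁ x₂ p q r t : ℝ} (h1 : |ν₁ - ν₂| ≤ p) (h2 : |x₁| ≤ q)
    (h3 : |ν₂| ≤ r) (h4 : |x₁ - x₂| ≤ t) : |ν₁ * x₁ - ν₂ * x₂| ≤ p * q + r * t := by
  have e : ν₁ * x₁ - ν₂ * x₂ = (ν₁ - ν₂) * x₁ + ν₂ * (x₁ - x₂) := by ring
  rw [e]
  refine (abs_add_le _ _).trans ?_
  rw [abs_mul, abs_mul]
  have := (abs_nonneg _).trans h1
  have := (abs_nonneg _).trans h3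
  gcongr

/-- Two affine functions `x ↦ aᵢ x + bᵢ`, weighted by `νᵢ`: if the weights vary monotonically with
the values at `uᵢ`, their contribution to the monotonicity inequality is negligible. -/
theorem weighted_row_sub_ge {a₁ a₂ : U →L[ℝ] ℝ} {b₁ b₂ ν₁ ν₂ K N d : ℝ} (hB : 1 ≤ B)
    (ha : ‖a₁ - a₂‖ ≤ d) (hb : |b₁ - b₂| ≤ d) (hu : ‖u₂‖ ≤ B)
    (hmono : 0 ≤ (ν₁ - ν₂) * ((a₁ u₁ + b₁) - (a₂ u₂ + b₂)))
    (hν : |ν₁ - ν₂| ≤ K * (d + ‖u₁ - u₂‖)) (hN : |ν₂| ≤ N) :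
    -((2 * B * K + N) * d * (d + ‖u₁ - u₂‖)) ≤ ν₁ * a₁ (u₁ - u₂) - ν₂ * a₂ (u₁ - u₂) := by
  have hd : 0 ≤ d := (norm_nonneg _).trans ha
  have hN0 : 0 ≤ N := (abs_nonneg _).trans hN
  set x₁ := -((a₁ - a₂) u₂) - (b₁ - b₂) with hx₁
  set x₂ := -((a₁ - a₂) u₁) - (b₁ - b₂) with hx₂
  have h1 : |x₁| ≤ d * B + d := by
    have e1 : |(a₁ - a₂) u₂| ≤ d * B := ((a₁ - a₂).le_opNorm u₂).trans (by gcongr)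
    calc |x₁| ≤ |-((a₁ - a₂) u₂)| + |b₁ - b₂| := abs_sub _ _
      _ ≤ d * B + d := by rw [abs_neg]; gcongr
  have h2 : |x₁ - x₂| ≤ d * ‖u₁ - u₂‖ := by
    have e : x₁ - x₂ = (a₁ - a₂) (u₁ - u₂) := by rw [hx₁, hx₂, map_sub]; ring
    rw [e]
    exact ((a₁ - a₂).le_opNorm _).trans (by gcongr)
  have h3 := abs_mul_sub_mul_le hν h1 hN h2
  have h4 : ν₁ * a₁ (u₁ - u₂) - ν₂ * a₂ (u₁ - u₂)
      = (ν₁ - ν₂) * ((a₁ u₁ + b₁) - (a₂ u₂ + b₂)) + (ν₁ * x₁ - ν₂ * x₂) := by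
    rw [hx₁, hx₂]
    simp only [sub_apply, map_sub]
    ring
  have h5 := neg_le_of_abs_le h3
  have h6 : K * (d + ‖u₁ - u₂‖) * (d * B + d) ≤ K * (d + ‖u₁ - u₂‖) * (2 * B * d) := by
    have := (abs_nonneg _).trans hν
    gcongr
    nlinarith
  have h7 : N * (d * ‖u₁ - u₂‖) ≤ N * (d * (d + ‖u₁ - u₂‖)) := by gcongr; linarith
  rw [h4]
  linarith

theorem abs_row_sub_le {a₁ a₂ : U →L[ℝ] ℝ} {b₁ b₂ d : ℝ} (hB : 1 ≤ B)
    (ha : ‖a₁ - a₂‖ ≤ d) (hb : |b₁ - b₂| ≤ d) (ha₁ : ‖a₁‖ ≤ B) (hu : ‖u₂‖ ≤ B) :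
    |(a₁ u₁ + b₁) - (a₂ u₂ + b₂)| ≤ 2 * B * (d + ‖u₁ - u₂‖) := by
  have hd : 0 ≤ d := (norm_nonneg _).trans ha
  have e : (a₁ u₁ + b₁) - (a₂ u₂ + b₂) = a₁ (u₁ - u₂) + (a₁ - a₂) u₂ + (b₁ - b₂) := by
    simp only [sub_apply, map_sub]; ring
  have h1 : |a₁ (u₁ - u₂)| ≤ B * ‖u₁ - u₂‖ := (a₁.le_opNorm _).trans (by gcongr)
  have h2 : |(a₁ - a₂) u₂| ≤ d * B := ((a₁ - a₂).le_opNorm _).trans (by gcongr)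
  rw [e]
  refine (abs_add_le _ _).trans ((add_le_add (abs_add_le _ _) hb).trans ?_)
  nlinarith [norm_nonneg (u₁ - u₂)]

theorem norm_mat_sub_le (hB : 1 ≤ B) (hθ₁ : ‖θ₁‖ ≤ B) (hu₂ : ‖u₂‖ ≤ B) :
    ‖θ₁.mat u₁ - θ₂.mat u₂‖ ≤ 2 * B * (‖θ₁ - θ₂‖ + ‖u₁ - u₂‖) := by
  have e : θ₁.mat u₁ - θ₂.mat u₂ = θ₁.2.2.2.2.2 (u₁ - u₂) + (θ₁ - θ₂).mat u₂ := by
    simp only [mat, Prod.snd_sub, Prod.fst_sub, sub_apply, map_sub]; abel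
  have h1 : ‖θ₁.2.2.2.2.2 (u₁ - u₂)‖ ≤ B * ‖u₁ - u₂‖ :=
    (ContinuousLinearMap.le_opNorm _ _).trans (by gcongr; exact θ₁.norm_matRow_le.trans hθ₁)
  have h2 := (θ₁ - θ₂).norm_mat_le u₂
  have h3 : ‖θ₁ - θ₂‖ * ‖u₂‖ ≤ ‖θ₁ - θ₂‖ * B := by gcongr
  rw [e]
  refine (norm_add_le _ _).trans ?_
  nlinarith [norm_nonneg (u₁ - u₂), norm_nonneg (θ₁ - θ₂)]

/-- Concavity of `rayMin` makes the spectral term monotone in the input, up to a negligible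
error. -/
theorem spectral_sub_le {g : ℝ} (hB : 1 ≤ B) (hu₂ : ‖u₂‖ ≤ B) {v₁ v₂ : H}
    (hv₁ : ‖v₁‖ = 1) (hv₂ : ‖v₂‖ = 1)
    (hm₁ : ⟪θ₁.mat u₁ v₁, v₁⟫_ℝ = rayMin (θ₁.mat u₁))
    (hm₂ : ⟪θ₂.mat u₂ v₂, v₂⟫_ℝ = rayMin (θ₂.mat u₂))
    (hv : ‖v₁ - v₂‖ ≤ 8 * B / g * (‖θ₁ - θ₂‖ + ‖u₁ - u₂‖)) :
    ⟪θ₁.2.2.2.2.2 (u₁ - u₂) v₁, v₁⟫_ℝ - ⟪θ₂.2.2.2.2.2 (u₁ - u₂) v₂, v₂⟫_ℝ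
      ≤ (1 + 32 * B ^ 2 / g) * ‖θ₁ - θ₂‖ * (‖θ₁ - θ₂‖ + ‖u₁ - u₂‖) := by
  set E := (θ₁ - θ₂).mat u₂ with hE
  have hEn : ‖E‖ ≤ 2 * B * ‖θ₁ - θ₂‖ := by
    have h1 := (θ₁ - θ₂).norm_mat_le u₂
    have h2 : ‖θ₁ - θ₂‖ * ‖u₂‖ ≤ ‖θ₁ - θ₂‖ * B := by gcongr
    nlinarith [norm_nonneg (θ₁ - θ₂)]
  have h1 := rayMin_le (θ₁.mat u₁) hv₂
  have h2 := rayMin_le (θ₂.mat u₂) hv₁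
  rw [← hm₁] at h1
  rw [← hm₂] at h2
  have e : ⟪θ₁.2.2.2.2.2 (u₁ - u₂) v₁, v₁⟫_ℝ - ⟪θ₂.2.2.2.2.2 (u₁ - u₂) v₂, v₂⟫_ℝ
      = (⟪θ₁.mat u₁ v₁, v₁⟫_ℝ - ⟪θ₁.mat u₁ v₂, v₂⟫_ℝ)
        + (⟪θ₂.mat u₂ v₂, v₂⟫_ℝ - ⟪θ₂.mat u₂ v₁, v₁⟫_ℝ)
        + ⟪(θ₁ - θ₂).2.2.2.2.2 (u₁ - u₂) v₂, v₂⟫_ℝ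
        + (⟪E (v₂ - v₁), v₂⟫_ℝ + ⟪E v₁, v₂ - v₁⟫_ℝ) := by
    simp only [hE, mat, Prod.snd_sub, Prod.fst_sub, sub_apply, add_apply, map_sub, inner_sub_left,
      inner_sub_right, inner_add_left]
    ring
  have h3 := (le_abs_self _).trans
    (abs_inner_apply_le ((θ₁ - θ₂).2.2.2.2.2 (u₁ - u₂)) v₂ v₂)
  have h4 := (le_abs_self _).trans (abs_inner_apply_le E (v₂ - v₁) v₂)
  have h5 := (le_abs_self _).trans (abs_inner_apply_le E v₁ (v₂ - v₁))
  have h6 : ‖(θ₁ - θ₂).2.2.2.2.2 (u₁ - u₂)‖ ≤ ‖θ₁ - θ₂‖ * ‖u₁ - u₂‖ :=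
    (ContinuousLinearMap.le_opNorm _ _).trans (by gcongr; exact norm_matRow_le _)
  have h7 : ‖E‖ * ‖v₁ - v₂‖
      ≤ 2 * B * ‖θ₁ - θ₂‖ * (8 * B / g * (‖θ₁ - θ₂‖ + ‖u₁ - u₂‖)) := by gcongr
  have h8 : 2 * B * ‖θ₁ - θ₂‖ * (8 * B / g * (‖θ₁ - θ₂‖ + ‖u₁ - u₂‖)) * 2
      = 32 * B ^ 2 / g * ‖θ₁ - θ₂‖ * (‖θ₁ - θ₂‖ + ‖u₁ - u₂‖) := by ring
  have h9 := mul_nonneg (norm_nonneg (θ₁ - θ₂)) (norm_nonneg (θ₁ - θ₂))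
  rw [norm_sub_rev v₂ v₁] at h4 h5
  rw [hv₂] at h3 h4
  rw [hv₁] at h5
  rw [e]
  linarith

theorem abs_max_lyap_sub_le (hB : 1 ≤ B) (hθ₁ : ‖θ₁‖ ≤ B) (hu₂ : ‖u₂‖ ≤ B) :
    |max 0 (θ₁.lyap u₁) - max 0 (θ₂.lyap u₂)| ≤ 2 * B * (‖θ₁ - θ₂‖ + ‖u₁ - u₂‖) := by
  have h := abs_max_sub_max_le_max 0 (θ₁.lyap u₁) 0 (θ₂.lyap u₂)
  rw [sub_zero, abs_zero, max_eq_right (abs_nonneg (θ₁.lyap u₁ - θ₂.lyap u₂))] at h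
  exact h.trans (abs_row_sub_le hB (norm_lyapRow_le (θ₁ - θ₂)) (norm_lyapConst_le (θ₁ - θ₂))
    ((norm_lyapRow_le θ₁).trans hθ₁) hu₂)

theorem abs_max_lyap_le (hB : 1 ≤ B) (hθ₂ : ‖θ₂‖ ≤ B) (hu₂ : ‖u₂‖ ≤ B) :
    |max 0 (θ₂.lyap u₂)| ≤ 2 * B ^ 2 := by
  have h1 : |θ₂.2.2.1 u₂| ≤ B * B :=
    (θ₂.2.2.1.le_opNorm u₂).trans (by gcongr; exact (norm_lyapRow_le θ₂).trans hθ₂)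
  have h2 : |θ₂.2.2.2.1| ≤ B := (norm_lyapConst_le θ₂).trans hθ₂
  rw [abs_of_nonneg (le_max_left _ _)]
  refine max_le (by positivity) ?_
  rw [lyap]
  nlinarith [le_abs_self (θ₂.2.2.1 u₂), le_abs_self θ₂.2.2.2.1]

/-- The slope is Lipschitz in data, input and minimizing vector. -/
theorem slope_sub_le {g : ℝ} (hc₁ : 0 ≤ c₁) (hc₂ : 0 ≤ c₂) (hB : 1 ≤ B)
    (hθ₁ : ‖θ₁‖ ≤ B) (hθ₂ : ‖θ₂‖ ≤ B) (hu₂ : ‖u₂‖ ≤ B) {v₁ v₂ : H}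
    (hv₁ : ‖v₁‖ = 1) (hv₂ : ‖v₂‖ = 1)
    (hv : ‖v₁ - v₂‖ ≤ 8 * B / g * (‖θ₁ - θ₂‖ + ‖u₁ - u₂‖)) (x : U) :
    |slope c₁ c₂ θ₁ u₁ v₁ x - slope c₁ c₂ θ₂ u₂ v₂ x|
      ≤ (2 + c₁ * (1 + 16 * B ^ 2 / g) + 8 * c₂ * B ^ 2) * (‖θ₁ - θ₂‖ + ‖u₁ - u₂‖) * ‖x‖ := by
  set d := ‖θ₁ - θ₂‖ with hd
  set s := d + ‖u₁ - u₂‖ with hs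
  have hd0 : 0 ≤ d := norm_nonneg (θ₁ - θ₂)
  have hds : d ≤ s := by rw [hs]; linarith [norm_nonneg (u₁ - u₂)]
  have hΔs : ‖u₁ - u₂‖ ≤ s := by rw [hs]; linarith
  have hx := norm_nonneg x
  have h1 : |⟪u₁ - u₂, x⟫_ℝ| ≤ s * ‖x‖ :=
    (abs_real_inner_le_norm _ _).trans (by gcongr)
  have h2 : |⟪θ₁.2.2.2.2.2 x v₁, v₁⟫_ℝ - ⟪θ₂.2.2.2.2.2 x v₂, v₂⟫_ℝ|
      ≤ (1 + 16 * B ^ 2 / g) * s * ‖x‖ := by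
    have e : ⟪θ₁.2.2.2.2.2 x v₁, v₁⟫_ℝ - ⟪θ₂.2.2.2.2.2 x v₂, v₂⟫_ℝ
        = ⟪(θ₁ - θ₂).2.2.2.2.2 x v₁, v₁⟫_ℝ + ⟪θ₂.2.2.2.2.2 x (v₁ - v₂), v₁⟫_ℝ
          + ⟪θ₂.2.2.2.2.2 x v₂, v₁ - v₂⟫_ℝ := by
      simp only [Prod.snd_sub, sub_apply, map_sub, inner_sub_left, inner_sub_right]
      ring
    have f1 := abs_inner_apply_le ((θ₁ - θ₂).2.2.2.2.2 x) v₁ v₁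
    have f2 := abs_inner_apply_le (θ₂.2.2.2.2.2 x) (v₁ - v₂) v₁
    have f3 := abs_inner_apply_le (θ₂.2.2.2.2.2 x) v₂ (v₁ - v₂)
    have f4 : ‖(θ₁ - θ₂).2.2.2.2.2 x‖ ≤ s * ‖x‖ :=
      (ContinuousLinearMap.le_opNorm _ _).trans
        (by gcongr; exact (norm_matRow_le (θ₁ - θ₂)).trans hds)
    have f5 : ‖θ₂.2.2.2.2.2 x‖ ≤ B * ‖x‖ :=
      (ContinuousLinearMap.le_opNorm _ _).trans
        (by gcongr; exact (norm_matRow_le θ₂).trans hθ₂)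
    have f6 : ‖θ₂.2.2.2.2.2 x‖ * ‖v₁ - v₂‖ ≤ B * ‖x‖ * (8 * B / g * s) := by gcongr
    rw [hv₁] at f1 f2
    rw [hv₂] at f3
    rw [e]
    refine (abs_add_le _ _).trans ((add_le_add_left (abs_add_le _ _) _).trans ?_)
    have f7 : B * ‖x‖ * (8 * B / g * s) * 2 = 16 * B ^ 2 / g * s * ‖x‖ := by ring
    linarith
  have h3 : |max 0 (θ₁.lyap u₁) * θ₁.2.2.1 x - max 0 (θ₂.lyap u₂) * θ₂.2.2.1 x|
      ≤ 4 * B ^ 2 * s * ‖x‖ := by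
    have f1 : |max 0 (θ₁.lyap u₁) - max 0 (θ₂.lyap u₂)| ≤ 2 * B * s :=
      (abs_max_lyap_sub_le (u₁ := u₁) hB hθ₁ hu₂)
    have f2 : |θ₁.2.2.1 x| ≤ B * ‖x‖ :=
      (θ₁.2.2.1.le_opNorm x).trans (by gcongr; exact (norm_lyapRow_le θ₁).trans hθ₁)
    have f3 := abs_max_lyap_le hB hθ₂ hu₂
    have f4 : |θ₁.2.2.1 x - θ₂.2.2.1 x| ≤ s * ‖x‖ :=
      ((θ₁ - θ₂).2.2.1.le_opNorm x).trans
        (by gcongr; exact (norm_lyapRow_le (θ₁ - θ₂)).trans hds)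
    refine (abs_mul_sub_mul_le f1 f2 f3 f4).trans (le_of_eq (by ring))
  have e : slope c₁ c₂ θ₁ u₁ v₁ x - slope c₁ c₂ θ₂ u₂ v₂ x = 2 * ⟪u₁ - u₂, x⟫_ℝ
      - c₁ * (⟪θ₁.2.2.2.2.2 x v₁, v₁⟫_ℝ - ⟪θ₂.2.2.2.2.2 x v₂, v₂⟫_ℝ)
      + 2 * c₂ * (max 0 (θ₁.lyap u₁) * θ₁.2.2.1 x - max 0 (θ₂.lyap u₂) * θ₂.2.2.1 x) := by
    simp only [slope, inner_sub_left]; ring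
  rw [abs_le] at h1 h2 h3
  have g1 := mul_le_mul_of_nonneg_left h2.1 hc₁
  have g2 := mul_le_mul_of_nonneg_left h2.2 hc₁
  have g3 := mul_le_mul_of_nonneg_left h3.1 hc₂
  have g4 := mul_le_mul_of_nonneg_left h3.2 hc₂
  rw [e, abs_le]
  constructor <;> linarith

theorem abs_slope_le (hc₁ : 0 ≤ c₁) (hc₂ : 0 ≤ c₂) (hB : 1 ≤ B)
    (hθ₂ : ‖θ₂‖ ≤ B) (hu₂ : ‖u₂‖ ≤ B) {v₂ : H} (hv₂ : ‖v₂‖ = 1) (x : U) :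
    |slope c₁ c₂ θ₂ u₂ v₂ x| ≤ (2 * B + c₁ * B + 4 * c₂ * B ^ 3) * ‖x‖ := by
  have h1 : |⟪u₂, x⟫_ℝ| ≤ B * ‖x‖ := (abs_real_inner_le_norm _ _).trans (by gcongr)
  have h2 : |⟪θ₂.2.2.2.2.2 x v₂, v₂⟫_ℝ| ≤ B * ‖x‖ := by
    refine (abs_inner_apply_le _ _ _).trans ?_
    rw [hv₂, mul_one, mul_one]
    exact (ContinuousLinearMap.le_opNorm _ _).trans
      (by gcongr; exact (norm_matRow_le θ₂).trans hθ₂)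
  have h3 : |max 0 (θ₂.lyap u₂) * θ₂.2.2.1 x| ≤ 2 * B ^ 2 * (B * ‖x‖) := by
    rw [abs_mul]
    have f1 := abs_max_lyap_le hB hθ₂ hu₂
    have f2 : |θ₂.2.2.1 x| ≤ B * ‖x‖ :=
      (θ₂.2.2.1.le_opNorm x).trans (by gcongr; exact (norm_lyapRow_le θ₂).trans hθ₂)
    gcongr
  rw [abs_le] at h1 h2 h3
  have g1 := mul_le_mul_of_nonneg_left h2.1 hc₁
  have g2 := mul_le_mul_of_nonneg_left h2.2 hc₁
  have g3 := mul_le_mul_of_nonneg_left h3.1 hc₂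
  have g4 := mul_le_mul_of_nonneg_left h3.2 hc₂
  rw [slope, abs_le]
  constructor <;> linarith

end Pair

variable [FiniteDimensional ℝ H] [Nontrivial H]

theorem slope_nonneg (hc₁ : 0 ≤ c₁) (hc₂ : 0 ≤ c₂) {θ : ProgData U H} {u : U}
    (hu : IsSol c₁ c₂ θ u) {g : ℝ} (hg : 0 < g) (hgap : HasGap (θ.mat u) g) {v : H} (hv : ‖v‖ = 1)
    (hvM : ⟪θ.mat u v, v⟫_ℝ = rayMin (θ.mat u)) {d : U}
    (hd : ∀ᶠ s in 𝓝[>] (0 : ℝ), 0 ≤ θ.barrier (u + s • d)) : 0 ≤ slope c₁ c₂ θ u v d := by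
  set C := ‖d‖ ^ 2 + c₁ * (8 / g * ‖θ.2.2.2.2.2 d‖ ^ 2) + c₂ * (θ.2.2.1 d) ^ 2 with hC
  have key : ∀ᶠ s in 𝓝[>] (0 : ℝ), 0 ≤ slope c₁ c₂ θ u v d + s * C := by
    filter_upwards [hd, self_mem_nhdsWithin] with s hs hs0
    have hs0 : 0 < s := hs0
    have h1 := hu.2 _ hs
    have h2 := hgap.le_rayMin_add hg hv hvM (s • θ.2.2.2.2.2 d)
    rw [← mat_add_smul, smul_apply, real_inner_smul_left, norm_smul, Real.norm_of_nonneg hs0.le]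
      at h2
    have h3 : (max 0 (θ.lyap (u + s • d))) ^ 2
        ≤ (max 0 (θ.lyap u)) ^ 2 + 2 * max 0 (θ.lyap u) * (s * θ.2.2.1 d)
          + (s * θ.2.2.1 d) ^ 2 := by
      have e1 : θ.lyap (u + s • d) = θ.lyap u + s * θ.2.2.1 d := by
        simp only [lyap, map_add, map_smul, smul_eq_mul]; ring
      have e2 : max 0 (θ.lyap (u + s • d)) ≤ |max 0 (θ.lyap u) + s * θ.2.2.1 d| := by
        refine max_le (abs_nonneg _) (le_trans ?_ (le_abs_self _))
        rw [e1]
        gcongr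
        exact le_max_right _ _
      have e3 := pow_le_pow_left₀ (le_max_left 0 (θ.lyap (u + s • d))) e2 2
      rw [sq_abs] at e3
      linarith
    have h4 : ⟪u + s • d, u + s • d⟫_ℝ = ⟪u, u⟫_ℝ + 2 * s * ⟪u, d⟫_ℝ + s ^ 2 * ‖d‖ ^ 2 := by
      simp only [inner_add_left, inner_add_right, real_inner_smul_left, real_inner_smul_right,
        real_inner_comm u d, real_inner_self_eq_norm_sq, norm_smul, mul_pow, Real.norm_eq_abs,
        sq_abs]
      ring
    simp only [obj, h4] at h1
    have h5 := mul_le_mul_of_nonneg_left h2 hc₁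
    have h6 := mul_le_mul_of_nonneg_left h3 hc₂
    have h7 : 0 ≤ s * (slope c₁ c₂ θ u v d + s * C) := by
      rw [slope, hC]; linarith
    exact nonneg_of_mul_nonneg_right h7 hs0
  have hlim : Tendsto (fun s : ℝ => slope c₁ c₂ θ u v d + s * C) (𝓝[>] 0)
      (𝓝 (slope c₁ c₂ θ u v d)) := by
    have hc : Continuous fun s : ℝ => slope c₁ c₂ θ u v d + s * C := by fun_prop
    simpa using (hc.tendsto 0).mono_left nhdsWithin_le_nhds
  exact ge_of_tendsto hlim key

/-- Karush-Kuhn-Tucker conditions. -/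
theorem exists_multiplier (hc₁ : 0 ≤ c₁) (hc₂ : 0 ≤ c₂) {θ : ProgData U H} (ha : θ.1 ≠ 0) {u : U}
    (hu : IsSol c₁ c₂ θ u) {g : ℝ} (hg : 0 < g) (hgap : HasGap (θ.mat u) g) {v : H} (hv : ‖v‖ = 1)
    (hvM : ⟪θ.mat u v, v⟫_ℝ = rayMin (θ.mat u)) :
    ∃ μ : ℝ, 0 ≤ μ ∧ μ * θ.barrier u = 0 ∧ ∀ d, slope c₁ c₂ θ u v d = μ * θ.1 d := by
  have hline : ∀ (d : U) (s : ℝ), θ.barrier (u + s • d) = θ.barrier u + s * θ.1 d := fun d s => by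
    simp only [barrier, map_add, map_smul, smul_eq_mul]; ring
  have htan : ∀ d, 0 ≤ θ.1 d → 0 ≤ slope c₁ c₂ θ u v d := fun d hd => by
    refine slope_nonneg hc₁ hc₂ hu hg hgap hv hvM ?_
    filter_upwards [self_mem_nhdsWithin] with s hs
    have hs : 0 < s := hs
    rw [hline]
    have := hu.1
    positivity
  have hneg : ∀ d, slope c₁ c₂ θ u v (-d) = -slope c₁ c₂ θ u v d := fun d => by
    rw [← neg_one_smul ℝ d, slope_smul]; ring
  obtain ⟨n, hn⟩ : ∃ n, θ.1 n = 1 := by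
    obtain ⟨d, hd⟩ : ∃ d, θ.1 d ≠ 0 := by
      by_contra! h
      exact ha (ContinuousLinearMap.ext h)
    exact ⟨(θ.1 d)⁻¹ • d, by rw [map_smul, smul_eq_mul, inv_mul_cancel₀ hd]⟩
  refine ⟨slope c₁ c₂ θ u v n, htan n (by rw [hn]; exact zero_le_one), ?_, fun d => ?_⟩
  · rcases hu.1.eq_or_lt with h | h
    · rw [← h, mul_zero]
    · -- the constraint is inactive, so that `-n` is an admissible direction as well
      have h1 : 0 ≤ slope c₁ c₂ θ u v (-n) := by
        refine slope_nonneg hc₁ hc₂ hu hg hgap hv hvM ?_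
        filter_upwards [Ioo_mem_nhdsGT h] with s hs
        rw [hline, map_neg, hn]
        linarith [hs.2]
      have h2 := htan n (by rw [hn]; exact zero_le_one)
      rw [hneg] at h1
      rw [show slope c₁ c₂ θ u v n = 0 by linarith, zero_mul]
  · have h0 : θ.1 (d + (-θ.1 d) • n) = 0 := by
      rw [map_add, map_smul, hn, smul_eq_mul]; ring
    have h1 := htan _ h0.ge
    have h2 := htan (-(d + (-θ.1 d) • n)) (by rw [map_neg, h0, neg_zero])
    rw [hneg] at h2
    have h3 : slope c₁ c₂ θ u v (d + (-θ.1 d) • n) = 0 := by linarith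
    rw [slope_add, slope_smul] at h3
    linarith

/-- On a set of data with uniform bounds, a uniform gap, and constraint rows bounded away from
zero, the solution is Lipschitz in the data. Subtracting the stationarity conditions of two
programs and testing with the difference of their solutions leaves the strong convexity of `‖u‖²`
on one side, and on the other side only errors of the size of the distance of the data times the
distance of data and solutions. -/
theorem exists_lipschitz [CompleteSpace U] (hc₁ : 0 ≤ c₁) (hc₂ : 0 ≤ c₂) {B g r : ℝ} (hB : 1 ≤ B)
    (hg : 0 < g) (hr : 0 < r) :
    ∃ L : ℝ, 0 ≤ L ∧ ∀ (θ₁ θ₂ : ProgData U H) (u₁ u₂ : U), ‖θ₁‖ ≤ B → ‖θ₂‖ ≤ B → ‖u₁‖ ≤ B →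
      ‖u₂‖ ≤ B → r ≤ ‖θ₁.1‖ → r ≤ ‖θ₂.1‖ → HasGap (θ₁.mat u₁) g → HasGap (θ₂.mat u₂) g →
      IsSol c₁ c₂ θ₁ u₁ → IsSol c₁ c₂ θ₂ u₂ → ‖u₁ - u₂‖ ≤ L * ‖θ₁ - θ₂‖ := by
  set K₀ := 2 * B + c₁ * B + 4 * c₂ * B ^ 3 with hK₀
  set K₁ := 2 + c₁ * (1 + 16 * B ^ 2 / g) + 8 * c₂ * B ^ 2 with hK₁
  set K₂ := (K₁ + K₀ / r) / r with hK₂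
  set C := c₁ * (1 + 32 * B ^ 2 / g) + 2 * c₂ * (2 * B * (2 * B) + 2 * B ^ 2)
    + (2 * B * K₂ + K₀ / r) with hC
  have hK₀0 : 0 ≤ K₀ := by positivity
  have hK₁0 : 0 ≤ K₁ := by positivity
  have hK₂0 : 0 ≤ K₂ := by positivity
  have hC0 : 0 ≤ C := by positivity
  refine ⟨C + 1, by positivity, fun θ₁ θ₂ u₁ u₂ hθ₁ hθ₂ hu₁ hu₂ hr₁ hr₂ hg₁ hg₂ hs₁ hs₂ => ?_⟩
  have ha₁ : θ₁.1 ≠ 0 := norm_pos_iff.1 (hr.trans_le hr₁)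
  have ha₂ : θ₂.1 ≠ 0 := norm_pos_iff.1 (hr.trans_le hr₂)
  obtain ⟨v₁, hv₁, hm₁⟩ := exists_eq_rayMin (θ₁.mat u₁)
  obtain ⟨v₂, hv₂, hm₂, hv⟩ : ∃ v : H, ‖v‖ = 1 ∧ ⟪θ₂.mat u₂ v, v⟫_ℝ = rayMin (θ₂.mat u₂) ∧
      0 ≤ ⟪v₁, v⟫_ℝ := by
    obtain ⟨w, hw, hwN⟩ := exists_eq_rayMin (θ₂.mat u₂)
    rcases le_total 0 ⟪v₁, w⟫_ℝ with h | h
    · exact ⟨w, hw, hwN, h⟩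
    · exact ⟨-w, by rwa [norm_neg], by rwa [map_neg, inner_neg_neg], by
        rw [inner_neg_right]; linarith⟩
  set d := ‖θ₁ - θ₂‖ with hd
  set Δ := ‖u₁ - u₂‖ with hΔ
  have hd0 : 0 ≤ d := norm_nonneg (θ₁ - θ₂)
  have hΔ0 : 0 ≤ Δ := norm_nonneg _
  have hvv : ‖v₁ - v₂‖ ≤ 8 * B / g * (d + Δ) := by
    have h1 := hg₂.mul_norm_sub_le hg hv₂ hv₁ hm₂ hm₁ hv
    have h2 := norm_mat_sub_le (θ₂ := θ₂) (u₁ := u₁) hB hθ₁ hu₂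
    rw [norm_sub_rev (θ₂.mat u₂)] at h1
    rw [div_mul_eq_mul_div, le_div_iff₀ hg]
    linarith
  obtain ⟨μ₁, hμ₁, hcomp₁, hkkt₁⟩ := exists_multiplier hc₁ hc₂ ha₁ hs₁ hg hg₁ hv₁ hm₁
  obtain ⟨μ₂, hμ₂, hcomp₂, hkkt₂⟩ := exists_multiplier hc₁ hc₂ ha₂ hs₂ hg hg₂ hv₂ hm₂
  -- the gradients of the constraints, to solve the stationarity conditions for the multipliers
  have hnormal : ∀ a : U →L[ℝ] ℝ, ∃ n : U, ‖n‖ = ‖a‖ ∧ a n = ‖a‖ ^ 2 := fun a => by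
    refine ⟨(InnerProductSpace.toDual ℝ U).symm a, by simp, ?_⟩
    rw [← LinearIsometryEquiv.norm_map (InnerProductSpace.toDual ℝ U).symm a,
      ← real_inner_self_eq_norm_sq, InnerProductSpace.toDual_symm_apply]
  have hμ₂le : μ₂ ≤ K₀ / r := by
    obtain ⟨n, hn, han⟩ := hnormal θ₂.1
    have h1 := (le_abs_self _).trans (abs_slope_le hc₁ hc₂ hB hθ₂ hu₂ hv₂ n)
    rw [hkkt₂, han, hn] at h1
    have h2 : μ₂ * ‖θ₂.1‖ ≤ K₀ := by
      refine le_of_mul_le_mul_right ?_ (hr.trans_le hr₂)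
      linarith
    rw [le_div_iff₀ hr]
    exact (mul_le_mul_of_nonneg_left hr₂ hμ₂).trans h2
  have hμsub : |μ₁ - μ₂| ≤ K₂ * (d + Δ) := by
    obtain ⟨n, hn, han⟩ := hnormal θ₁.1
    have h1 := slope_sub_le (g := g) (u₁ := u₁) hc₁ hc₂ hB hθ₁ hθ₂ hu₂ hv₁ hv₂ hvv n
    have h2 : |μ₂ * (θ₂.1 n - θ₁.1 n)| ≤ K₀ / r * (d * ‖n‖) := by
      rw [abs_mul, abs_of_nonneg hμ₂, abs_sub_comm]
      gcongr
      exact ((θ₁ - θ₂).1.le_opNorm n).trans (by gcongr; exact norm_barrierRow_le (θ₁ - θ₂))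
    have h3 : (μ₁ - μ₂) * ‖θ₁.1‖ ^ 2 = slope c₁ c₂ θ₁ u₁ v₁ n - slope c₁ c₂ θ₂ u₂ v₂ n
        + μ₂ * (θ₂.1 n - θ₁.1 n) := by
      rw [hkkt₁, hkkt₂, ← han]; ring
    have h4 : |μ₁ - μ₂| * ‖θ₁.1‖ ^ 2 ≤ (K₁ + K₀ / r) * (d + Δ) * ‖θ₁.1‖ := by
      rw [← abs_of_nonneg (sq_nonneg ‖θ₁.1‖), ← abs_mul, h3]
      refine (abs_add_le _ _).trans ((add_le_add h1 h2).trans ?_)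
      rw [hn]
      have : 0 ≤ K₀ / r * ‖θ₁.1‖ * Δ := by positivity
      linarith
    have h5 : |μ₁ - μ₂| * ‖θ₁.1‖ ≤ (K₁ + K₀ / r) * (d + Δ) := by
      refine le_of_mul_le_mul_right ?_ (hr.trans_le hr₁)
      linarith
    rw [hK₂, div_mul_eq_mul_div, le_div_iff₀ hr]
    exact (mul_le_mul_of_nonneg_left hr₁ (abs_nonneg _)).trans h5
  have hspec := spectral_sub_le hB hu₂ hv₁ hv₂ hm₁ hm₂ hvv
  have hhinge := weighted_row_sub_ge (u₁ := u₁) (K := 2 * B) (N := 2 * B ^ 2) (d := d)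
    (ν₁ := max 0 (θ₁.lyap u₁)) (ν₂ := max 0 (θ₂.lyap u₂)) (b₁ := θ₁.2.2.2.1) (b₂ := θ₂.2.2.2.1) hB
    (norm_lyapRow_le (θ₁ - θ₂)) (norm_lyapConst_le (θ₁ - θ₂)) hu₂ (by
      show 0 ≤ (max 0 (θ₁.lyap u₁) - max 0 (θ₂.lyap u₂)) * (θ₁.lyap u₁ - θ₂.lyap u₂)
      rcases le_total (θ₁.lyap u₁) (θ₂.lyap u₂) with h | h
      · exact mul_nonneg_of_nonpos_of_nonpos (sub_nonpos.2 (max_le_max_left 0 h))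
          (sub_nonpos.2 h)
      · exact mul_nonneg (sub_nonneg.2 (max_le_max_left 0 h)) (sub_nonneg.2 h))
    (abs_max_lyap_sub_le hB hθ₁ hu₂) (abs_max_lyap_le hB hθ₂ hu₂)
  have hmult := weighted_row_sub_ge (u₁ := u₁) (K := K₂) (N := K₀ / r) (d := d)
    (ν₁ := -μ₁) (ν₂ := -μ₂) (b₁ := θ₁.2.1) (b₂ := θ₂.2.1) hB
    (norm_barrierRow_le (θ₁ - θ₂)) (norm_barrierConst_le (θ₁ - θ₂)) hu₂ (by
      show 0 ≤ (-μ₁ - -μ₂) * (θ₁.barrier u₁ - θ₂.barrier u₂)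
      have h1 := mul_nonneg hμ₁ hs₂.1
      have h2 := mul_nonneg hμ₂ hs₁.1
      linarith)
    (by rwa [neg_sub_neg, abs_sub_comm]) (by rwa [abs_neg, abs_of_nonneg hμ₂])
  have hsum : 2 * Δ ^ 2 ≤ C * d * (d + Δ) := by
    have h1 := hkkt₁ (u₁ - u₂)
    have h2 := hkkt₂ (u₁ - u₂)
    rw [slope] at h1 h2
    have h3 : ⟪u₁, u₁ - u₂⟫_ℝ - ⟪u₂, u₁ - u₂⟫_ℝ = Δ ^ 2 := by
      rw [← inner_sub_left, real_inner_self_eq_norm_sq]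
    have h4 := mul_le_mul_of_nonneg_left hspec hc₁
    have h5 := mul_le_mul_of_nonneg_left hhinge hc₂
    rw [hC]
    linarith
  clear_value C
  by_contra! hcon
  have hCd : 0 ≤ C * d := mul_nonneg hC0 hd0
  have h1 : d ≤ Δ := by linarith
  have h2 : C * d < Δ := by linarith
  have h3 : C * d * (d + Δ) ≤ C * d * (2 * Δ) := by gcongr; linarith
  have h4 : C * d * (2 * Δ) < Δ * (2 * Δ) :=
    mul_lt_mul_of_pos_right h2 (by linarith)
  linarith

end ProgData

/-! ### Symmetric matrices between two multiples of the identity -/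

/-- Transposition as a continuous linear map. -/
noncomputable def transpL (m n : ℕ) : Mat m n →L[ℝ] Mat n m :=
  LinearMap.toContinuousLinearMap
    { toFun := fun A => transp A
      map_add' := fun A B => by simp
      map_smul' := fun c A => by simp }

theorem transpL_apply {m n : ℕ} (A : Mat m n) : transpL m n A = transp A := rfl

section Bounds

variable {n : ℕ} {M : Mat n n} {a b : ℝ}

theorem mem_Icc_smul_one_iff : M ∈ Icc (a • (1 : Mat n n)) (b • 1) ↔
    IsSelfAdjoint M ∧ ∀ v : Vec n, a * ‖v‖ ^ 2 ≤ ⟪M v, v⟫_ℝ ∧ ⟪M v, v⟫_ℝ ≤ b * ‖v‖ ^ 2 := by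
  have hone : ∀ c : ℝ, IsSelfAdjoint (c • (1 : Mat n n)) := fun c =>
    IsSelfAdjoint.smul (IsSelfAdjoint.all c) (IsSelfAdjoint.one _)
  simp only [mem_Icc, ContinuousLinearMap.le_def, ContinuousLinearMap.isPositive_def',
    ContinuousLinearMap.reApplyInnerSelf_apply, RCLike.re_to_real, sub_apply, smul_apply,
    one_apply_eq_self, inner_sub_left, real_inner_smul_left,
    real_inner_self_eq_norm_sq, sub_nonneg]
  constructor
  · rintro ⟨⟨h1, h2⟩, -, h3⟩
    exact ⟨by simpa using h1.add (hone a), fun v => ⟨h2 v, h3 v⟩⟩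
  · rintro ⟨h1, h2⟩
    exact ⟨⟨h1.sub (hone a), fun v => (h2 v).1⟩, (hone b).sub h1, fun v => (h2 v).2⟩

theorem isUnit_of_mem_Icc (ha : 0 < a) (hM : M ∈ Icc (a • (1 : Mat n n)) (b • 1)) : IsUnit M := by
  refine ContinuousLinearMap.isUnit_of_forall_le_norm_inner_map M (c := a.toNNReal)
    (Real.toNNReal_pos.2 ha) fun v => ?_
  have h := ((mem_Icc_smul_one_iff.1 hM).2 v).1
  rw [Real.coe_toNNReal _ ha.le, mul_comm]
  exact h.trans (le_abs_self _)

theorem norm_apply_le_of_mem_Icc (ha : 0 ≤ a) (hb : 0 < b)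
    (hM : M ∈ Icc (a • (1 : Mat n n)) (b • 1)) (v : Vec n) : ‖M v‖ ≤ b * ‖v‖ := by
  obtain ⟨hsa, hM⟩ := mem_Icc_smul_one_iff.1 hM
  -- positivity of the form at `M v - b v`, with `⟪M (M v), M v⟫ ≤ b ‖M v‖²`
  have h1 := (hM (M v - b • v)).1
  have h2 := (hM (M v)).2
  have h3 := (hM v).2
  have hsym : ⟪M (M v), v⟫_ℝ = ‖M v‖ ^ 2 := by
    rw [← real_inner_self_eq_norm_sq]; exact hsa.isSymmetric (M v) v
  have h4 : ⟪M (M v - b • v), M v - b • v⟫_ℝ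
      = ⟪M (M v), M v⟫_ℝ - 2 * b * ‖M v‖ ^ 2 + b ^ 2 * ⟪M v, v⟫_ℝ := by
    simp only [map_sub, map_smul, inner_sub_left, inner_sub_right, real_inner_smul_left,
      real_inner_smul_right, hsym, real_inner_self_eq_norm_sq]
    ring
  have h5 : 0 ≤ a * ‖M v - b • v‖ ^ 2 := by positivity
  have h6 : b * ‖M v‖ ^ 2 ≤ b * (b * ‖v‖) ^ 2 := by
    have := mul_le_mul_of_nonneg_left h3 (sq_nonneg b)
    nlinarith
  exact (pow_le_pow_iff_left₀ (norm_nonneg _) (by positivity) two_ne_zero).1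
    (le_of_mul_le_mul_left h6 hb)

theorem isCompact_Icc_smul_one (ha : 0 ≤ a) (hb : 0 < b) :
    IsCompact (Icc (a • (1 : Mat n n)) (b • 1)) := by
  refine Metric.isCompact_of_isClosed_isBounded ?_ ?_
  · have h : Icc (a • (1 : Mat n n)) (b • 1) = {M | IsSelfAdjoint M} ∩
        ⋂ v : Vec n, {M | a * ‖v‖ ^ 2 ≤ ⟪M v, v⟫_ℝ ∧ ⟪M v, v⟫_ℝ ≤ b * ‖v‖ ^ 2} := by
      ext M
      rw [mem_Icc_smul_one_iff]
      simp
    rw [h]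
    have hcont : ∀ v : Vec n, Continuous fun M : Mat n n => ⟪M v, v⟫_ℝ := fun v => by fun_prop
    refine (isClosed_eq (transpL n n).continuous continuous_id).inter (isClosed_iInter fun v => ?_)
    exact (isClosed_le continuous_const (hcont v)).inter (isClosed_le (hcont v) continuous_const)
  · refine (Metric.isBounded_closedBall (x := (0 : Mat n n)) (r := b)).subset fun M hM => ?_
    rw [mem_closedBall_zero_iff]
    exact M.opNorm_le_bound hb.le (norm_apply_le_of_mem_Icc ha hb hM)

theorem minv_eq_ringInverse (M : Mat n n) : minv M = Ring.inverse M := by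
  rw [minv, ← ContinuousLinearMap.ringInverse_eq_inverse]

theorem minv_minv (hM : IsUnit M) : minv (minv M) = M := by
  rw [minv_eq_ringInverse, minv_eq_ringInverse, Ring.inverse_inverse hM]

theorem isSelfAdjoint_minv (hM : IsSelfAdjoint M) : IsSelfAdjoint (minv M) := by
  rw [minv_eq_ringInverse]; exact hM.ringInverse

theorem apply_minv_apply (hM : IsUnit M) (v : Vec n) : M (minv M v) = v := by
  rw [minv_eq_ringInverse]
  exact DFunLike.congr_fun (Ring.mul_inverse_cancel M hM) v

theorem SymPosDef.isUnit (hM : SymPosDef M) : IsUnit M := by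
  rw [ContinuousLinearMap.isUnit_iff_bijective]
  have hinj : Function.Injective M := by
    rw [injective_iff_map_eq_zero]
    intro v hv
    by_contra h0
    have := hM.2 v h0
    rw [hv, inner_zero_left] at this
    exact this.false
  exact ⟨hinj, LinearMap.injective_iff_surjective (f := (M : Vec n →ₗ[ℝ] Vec n)).1 hinj⟩

theorem SymPosDef.inner_nonneg (hM : SymPosDef M) (v : Vec n) : 0 ≤ ⟪M v, v⟫_ℝ := by
  rcases eq_or_ne v 0 with rfl | h
  · simp
  · exact (hM.2 v h).le

theorem SymPosDef.minv_inner_nonneg (hM : SymPosDef M) (v : Vec n) : 0 ≤ ⟪minv M v, v⟫_ℝ := by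
  have h := hM.inner_nonneg (minv M v)
  rwa [apply_minv_apply hM.isUnit, real_inner_comm] at h

theorem SymPosDef.exists_lower_bound [NeZero n] (hM : SymPosDef M) :
    ∃ c > 0, ∀ v : Vec n, c * ‖v‖ ^ 2 ≤ ⟪M v, v⟫_ℝ := by
  obtain ⟨v, hv, h⟩ := exists_eq_rayMin M
  exact ⟨rayMin M, h ▸ hM.2 v (by rintro rfl; simp at hv), rayMin_mul_sq_le M⟩

end Bounds

/-! ### The data of the program as a function of uncertainty, estimate and output -/

namespace Problem

variable {nx nu nz : ℕ} (p : Problem nx nu nz)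

/-- Uncertainties that satisfy the uniform bounds. -/
def uncertainties : Set (Mat nx nx) := Icc (p.plow • (1 : Mat nx nx)) (p.phigh • 1)

/-- The data of the program at uncertainty `P`, estimate `x̂` and output `z`. -/
noncomputable def data (y : Mat nx nx × Vec nx × Vec nz) : ProgData (Vec nu) (Vec nx) :=
  (p.Lg p.h y.2.1,
   p.Lf p.h y.2.1 + p.α * p.h y.2.1
    + fderiv ℝ p.h y.2.1 (y.1 (transp (p.C y.2.1) (minv p.R (y.2.2 - p.q y.2.1)))),
   p.Lg p.V y.2.1,
   p.Lf p.V y.2.1 + p.γ * p.V y.2.1,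
   minv y.1 + p.Δt • (-(p.κ • minv y.1) - transp (fderiv ℝ p.f y.2.1) ∘L minv y.1
    - minv y.1 ∘L fderiv ℝ p.f y.2.1 + transp (p.C y.2.1) ∘L minv p.R ∘L p.C y.2.1
    - minv y.1 ∘L p.Q ∘L minv y.1),
   -p.Δt • (((ContinuousLinearMap.compL ℝ _ _ _).flip (minv y.1) ∘L transpL nx nx
    + ContinuousLinearMap.compL ℝ _ _ _ (minv y.1)) ∘L (fderiv ℝ p.g y.2.1).flip))

variable {p}

theorem Standing.exists_smooth_domain (hp : p.Standing) (hV : p.IsCLF)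
    (hh : p.IsBarrierCandidate) : ∃ D : Set (Vec nx), IsOpen D ∧ p.dom ⊆ D ∧ ContDiffOn ℝ 2 p.f D ∧
      ContDiffOn ℝ 2 p.g D ∧ ContDiffOn ℝ 2 p.q D ∧ ContDiffOn ℝ 2 p.V D ∧
      ContDiffOn ℝ 2 p.h D := by
  obtain ⟨D₁, o₁, i₁, s₁⟩ := hp.smooth_f
  obtain ⟨D₂, o₂, i₂, s₂⟩ := hp.smooth_g
  obtain ⟨D₃, o₃, i₃, s₃⟩ := hp.smooth_q
  obtain ⟨D₄, o₄, i₄, s₄⟩ := hV.smooth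
  obtain ⟨D₅, o₅, i₅, s₅⟩ := hh.smooth
  refine ⟨D₁ ∩ (D₂ ∩ (D₃ ∩ (D₄ ∩ D₅))), o₁.inter (o₂.inter (o₃.inter (o₄.inter o₅))),
    subset_inter i₁ (subset_inter i₂ (subset_inter i₃ (subset_inter i₄ i₅))),
    s₁.mono fun x hx => hx.1, s₂.mono fun x hx => hx.2.1, s₃.mono fun x hx => hx.2.2.1,
    s₄.mono fun x hx => hx.2.2.2.1, s₅.mono fun x hx => hx.2.2.2.2⟩

theorem contDiffOn_data {D : Set (Vec nx)} (hD : IsOpen D) (hf : ContDiffOn ℝ 2 p.f D)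
    (hg : ContDiffOn ℝ 2 p.g D) (hq : ContDiffOn ℝ 2 p.q D) (hV : ContDiffOn ℝ 2 p.V D)
    (hh : ContDiffOn ℝ 2 p.h D) :
    ContDiffOn ℝ 1 p.data ({P : Mat nx nx | IsUnit P} ×ˢ D ×ˢ univ) := by
  set O : Set (Mat nx nx × Vec nx × Vec nz) := {P : Mat nx nx | IsUnit P} ×ˢ D ×ˢ univ with hO
  have hmap : MapsTo (fun y : Mat nx nx × Vec nx × Vec nz => y.2.1) O D := fun y hy => hy.2.1
  have hproj : ContDiffOn ℝ 1 (fun y : Mat nx nx × Vec nx × Vec nz => y.2.1) O :=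
    contDiff_fst.comp contDiff_snd |>.contDiffOn
  have lift : ∀ {F : Type} [NormedAddCommGroup F] [NormedSpace ℝ F] {φ : Vec nx → F},
      ContDiffOn ℝ 2 φ D → ContDiffOn ℝ 1 (fun y : Mat nx nx × Vec nx × Vec nz => φ y.2.1) O :=
    fun h => (h.of_le one_le_two).comp hproj hmap
  have lift' : ∀ {F : Type} [NormedAddCommGroup F] [NormedSpace ℝ F] {φ : Vec nx → F},
      ContDiffOn ℝ 2 φ D →
      ContDiffOn ℝ 1 (fun y : Mat nx nx × Vec nx × Vec nz => fderiv ℝ φ y.2.1) O :=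
    fun h => (h.fderiv_of_isOpen hD (by norm_num)).comp hproj hmap
  have hP : ContDiffOn ℝ 1 (fun y : Mat nx nx × Vec nx × Vec nz => y.1) O :=
    contDiff_fst.contDiffOn
  have hz : ContDiffOn ℝ 1 (fun y : Mat nx nx × Vec nx × Vec nz => y.2.2) O :=
    (contDiff_snd.comp contDiff_snd).contDiffOn
  have hS : ContDiffOn ℝ 1 (fun y : Mat nx nx × Vec nx × Vec nz => minv y.1) O := by
    simp only [minv_eq_ringInverse]
    intro y hy
    obtain ⟨w, hw⟩ : IsUnit y.1 := hy.1
    exact (hw ▸ contDiffAt_ringInverse ℝ w : ContDiffAt ℝ 1 Ring.inverse y.1).comp_contDiffWithinAt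
      y (hP y hy)
  have hf0 := lift hf
  have hg0 := lift hg
  have hq0 := lift hq
  have hV0 := lift hV
  have hh0 := lift hh
  have hf1 := lift' hf
  have hg1 := lift' hg
  have hq1 := lift' hq
  have hV1 := lift' hV
  have hh1 := lift' hh
  have hC : ContDiffOn ℝ 1 (fun y : Mat nx nx × Vec nx × Vec nz => p.C y.2.1) O := hq1
  have hCt : ContDiffOn ℝ 1 (fun y : Mat nx nx × Vec nx × Vec nz => transp (p.C y.2.1)) O :=
    (transpL nz nx).contDiff.comp_contDiffOn hC
  have hft : ContDiffOn ℝ 1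
      (fun y : Mat nx nx × Vec nx × Vec nz => transp (fderiv ℝ p.f y.2.1)) O :=
    (transpL nx nx).contDiff.comp_contDiffOn hf1
  have hflip : ContDiff ℝ 1 (fun T : Vec nx →L[ℝ] Vec nu →L[ℝ] Vec nx => T.flip) :=
    ContinuousLinearMap.contDiff (LinearMap.toContinuousLinearMap
      { toFun := fun T : Vec nx →L[ℝ] Vec nu →L[ℝ] Vec nx => T.flip
        map_add' := fun _ _ => rfl
        map_smul' := fun _ _ => rfl })
  have hgf : ContDiffOn ℝ 1
      (fun y : Mat nx nx × Vec nx × Vec nz => (fderiv ℝ p.g y.2.1).flip) O :=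
    hflip.comp_contDiffOn hg1
  have hc1 : ContDiffOn ℝ 1 (fun y : Mat nx nx × Vec nx × Vec nz =>
      (ContinuousLinearMap.compL ℝ (Vec nx) (Vec nx) (Vec nx)).flip (minv y.1)) O :=
    (ContinuousLinearMap.contDiff _).comp_contDiffOn hS
  have hc2 : ContDiffOn ℝ 1 (fun y : Mat nx nx × Vec nx × Vec nz =>
      ContinuousLinearMap.compL ℝ (Vec nx) (Vec nx) (Vec nx) (minv y.1)) O :=
    (ContinuousLinearMap.contDiff _).comp_contDiffOn hS
  have hc3 : ContDiffOn ℝ 1 (fun y : Mat nx nx × Vec nx × Vec nz =>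
      ((ContinuousLinearMap.compL ℝ (Vec nx) (Vec nx) (Vec nx)).flip (minv y.1) ∘L transpL nx nx
        + ContinuousLinearMap.compL ℝ (Vec nx) (Vec nx) (Vec nx) (minv y.1))
        ∘L (fderiv ℝ p.g y.2.1).flip) O :=
    ((hc1.clm_comp contDiffOn_const).add hc2).clm_comp hgf
  have hm1 : ContDiffOn ℝ 1 (fun y : Mat nx nx × Vec nx × Vec nz => -(p.κ • minv y.1)) O :=
    (hS.const_smul p.κ).neg
  have hm2 := hft.clm_comp hS
  have hm3 := hS.clm_comp hf1
  have hm4 : ContDiffOn ℝ 1 (fun y : Mat nx nx × Vec nx × Vec nz =>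
      transp (p.C y.2.1) ∘L minv p.R ∘L p.C y.2.1) O :=
    hCt.clm_comp (contDiffOn_const.clm_comp hC)
  have hm5 : ContDiffOn ℝ 1 (fun y : Mat nx nx × Vec nx × Vec nz =>
      minv y.1 ∘L p.Q ∘L minv y.1) O :=
    hS.clm_comp (contDiffOn_const.clm_comp hS)
  have hpred : ContDiffOn ℝ 1 (fun y : Mat nx nx × Vec nx × Vec nz =>
      p.Δt • (-(p.κ • minv y.1) - transp (fderiv ℝ p.f y.2.1) ∘L minv y.1
        - minv y.1 ∘L fderiv ℝ p.f y.2.1 + transp (p.C y.2.1) ∘L minv p.R ∘L p.C y.2.1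
        - minv y.1 ∘L p.Q ∘L minv y.1)) O :=
    ((((hm1.sub hm2).sub hm3).add hm4).sub hm5).const_smul p.Δt
  unfold data
  refine ContDiffOn.prodMk ?_ (ContDiffOn.prodMk ?_ (ContDiffOn.prodMk ?_ (ContDiffOn.prodMk ?_
    (ContDiffOn.prodMk ?_ ?_))))
  · exact hh1.clm_comp hg0
  · refine ((hh1.clm_apply hf0).add (contDiffOn_const.mul hh0)).add (hh1.clm_apply ?_)
    exact hP.clm_apply (hCt.clm_apply (contDiffOn_const.clm_apply (hz.sub hq0)))
  · exact hV1.clm_comp hg0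
  · exact (hV1.clm_apply hf0).add (contDiffOn_const.mul hV0)
  · exact hS.add hpred
  · exact hc3.const_smul _

theorem isOpen_data_domain {D : Set (Vec nx)} (hD : IsOpen D) :
    IsOpen ({P : Mat nx nx | IsUnit P} ×ˢ D ×ˢ (univ : Set (Vec nz))) :=
  Units.isOpen.prod (hD.prod isOpen_univ)

end Problem

/-! ### The controller -/

namespace Problem

variable {nx nu nz : ℕ} {p : Problem nx nu nz}

theorem A_eq {xh : Vec nx} (hg : DifferentiableAt ℝ p.g xh) (u : Vec nu) :
    p.A xh u = fderiv ℝ p.f xh + (fderiv ℝ p.g xh).flip u := by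
  have h := (hg.hasFDerivAt.clm_apply (hasFDerivAt_const u xh)).fderiv
  rw [A, h]
  congr 1
  ext v
  simp

theorem mat_data {xh : Vec nx} (hg : DifferentiableAt ℝ p.g xh) (P : Mat nx nx) (z : Vec nz)
    (u : Vec nu) : (p.data (P, xh, z)).mat u = p.predict (minv P) xh u := by
  simp only [ProgData.mat, data, predict, A_eq hg, map_add, ContinuousLinearMap.add_comp,
    ContinuousLinearMap.comp_add, add_apply, smul_apply, ContinuousLinearMap.comp_apply,
    transpL_apply, ContinuousLinearMap.compL_apply, ContinuousLinearMap.flip_apply]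
  module

theorem isSelfAdjoint_predict (hp : p.Standing) {S : Mat nx nx} (hS : IsSelfAdjoint S)
    (xh : Vec nx) (u : Vec nu) : IsSelfAdjoint (p.predict S xh u) := by
  have hS' := ContinuousLinearMap.isSelfAdjoint_iff'.1 hS
  have hQ := ContinuousLinearMap.isSelfAdjoint_iff'.1 hp.Q_pos.1
  have hR := ContinuousLinearMap.isSelfAdjoint_iff'.1 (isSelfAdjoint_minv hp.R_pos.1)
  rw [ContinuousLinearMap.isSelfAdjoint_iff']
  simp only [predict, map_add, map_sub, map_neg, map_smulₛₗ, ContinuousLinearMap.adjoint_comp,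
    ContinuousLinearMap.adjoint_adjoint, hS', hQ, hR, conj_trivial, ContinuousLinearMap.comp_assoc]
  module

theorem differentiableAt_g (hp : p.Standing) {xh : Vec nx} (hxh : xh ∈ p.dom) :
    DifferentiableAt ℝ p.g xh := by
  obtain ⟨D, hD, hsub, hc⟩ := hp.smooth_g
  exact (hc.contDiffAt (hD.mem_nhds (hsub hxh))).differentiableAt two_ne_zero

theorem isUnit_of_mem_uncertainties (hp : p.Standing) {P : Mat nx nx}
    (hP : P ∈ p.uncertainties) : IsUnit P :=
  isUnit_of_mem_Icc hp.plow_pos hP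

theorem isSelfAdjoint_mat_data (hp : p.Standing) {P : Mat nx nx} (hP : P ∈ p.uncertainties)
    {xh : Vec nx} (hxh : xh ∈ p.dom) (z : Vec nz) (u : Vec nu) :
    IsSelfAdjoint ((p.data (P, xh, z)).mat u) := by
  rw [mat_data (differentiableAt_g hp hxh)]
  exact isSelfAdjoint_predict hp (isSelfAdjoint_minv (mem_Icc_smul_one_iff.1 hP).1) _ _

theorem feasible_iff (hp : p.Standing) {P : Mat nx nx} (hP : P ∈ p.uncertainties) (xh : Vec nx)
    (z : Vec nz) (u : Vec nu) (δ : ℝ) : p.Feasible (minv P) xh z u δ ↔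
      (p.data (P, xh, z)).lyap u ≤ δ ∧ 0 ≤ (p.data (P, xh, z)).barrier u := by
  have h1 : p.Lf p.V xh + p.Lg p.V xh u + p.γ * p.V xh = (p.data (P, xh, z)).lyap u := by
    simp only [ProgData.lyap, data]; ring
  have h2 : p.Lf p.h xh + p.Lg p.h xh u + p.α * p.h xh
      + fderiv ℝ p.h xh (p.gain (minv P) xh (z - p.q xh)) = (p.data (P, xh, z)).barrier u := by
    simp only [ProgData.barrier, data, gain, minv_minv (isUnit_of_mem_uncertainties hp hP),
      ContinuousLinearMap.comp_apply]
    ring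
  rw [Feasible, h1, h2]

theorem cost_eq [NeZero nx] (hp : p.Standing) {P : Mat nx nx} (hP : P ∈ p.uncertainties)
    {xh : Vec nx} (hxh : xh ∈ p.dom) (z : Vec nz) (u : Vec nu) (δ : ℝ) :
    p.cost (minv P) xh u δ = ⟪u, u⟫_ℝ - p.c₁ * rayMin ((p.data (P, xh, z)).mat u)
      + p.c₂ * δ ^ 2 := by
  rw [cost, ← mat_data (differentiableAt_g hp hxh) P z,
    lambdaMin_eq_rayMin (isSelfAdjoint_mat_data hp hP hxh z u)]

/-- For a given input, the cheapest relaxation is the positive part of the Lyapunov term. -/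
theorem isMinimizer_iff [NeZero nx] (hp : p.Standing) {P : Mat nx nx} (hP : P ∈ p.uncertainties)
    {xh : Vec nx} (hxh : xh ∈ p.dom) (z : Vec nz) (u : Vec nu) (δ : ℝ) :
    p.IsMinimizer (minv P) xh z u δ ↔ ProgData.IsSol p.c₁ p.c₂ (p.data (P, xh, z)) u ∧
      δ = max 0 ((p.data (P, xh, z)).lyap u) := by
  have hc₂ := hp.c₂_pos
  simp only [IsMinimizer, feasible_iff hp hP, cost_eq hp hP hxh z, ProgData.IsSol, ProgData.obj]
  set θ := p.data (P, xh, z)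
  have hsq : ∀ (u : Vec nu) (δ : ℝ), θ.lyap u ≤ δ → (max 0 (θ.lyap u)) ^ 2 ≤ δ ^ 2 := by
    intro u δ h
    rcases le_total 0 (θ.lyap u) with h0 | h0
    · rw [max_eq_right h0]
      exact pow_le_pow_left₀ h0 h 2
    · rw [max_eq_left h0]
      simpa using sq_nonneg δ
  constructor
  · rintro ⟨⟨h1, h2⟩, h3⟩
    have h4 := mul_le_mul_of_nonneg_left (hsq u δ h1) hc₂.le
    refine ⟨⟨h2, fun w hw => ?_⟩, ?_⟩
    · have := h3 w _ ⟨le_max_right 0 (θ.lyap w), hw⟩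
      linarith
    · have h5 := h3 u _ ⟨le_max_right 0 (θ.lyap u), h2⟩
      have h6 : δ ^ 2 ≤ (max 0 (θ.lyap u)) ^ 2 := by
        refine le_of_mul_le_mul_left ?_ hc₂
        linarith
      have h7 : |δ| = max 0 (θ.lyap u) := by
        rw [← abs_of_nonneg (le_max_left 0 (θ.lyap u)), ← sq_eq_sq_iff_abs_eq_abs]
        exact le_antisymm h6 (hsq u δ h1)
      rcases le_total 0 δ with h0 | h0
      · rwa [abs_of_nonneg h0] at h7
      · rw [abs_of_nonpos h0, max_eq_left (h1.trans h0)] at h7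
        rw [max_eq_left (h1.trans h0)]
        linarith
  · rintro ⟨⟨h1, h2⟩, rfl⟩
    refine ⟨⟨le_max_right _ _, h1⟩, fun w δ' hw => ?_⟩
    have h3 := h2 w hw.2
    have h4 := mul_le_mul_of_nonneg_left (hsq w δ' hw.1) hc₂.le
    linarith

theorem data_row_ne_zero (hh : p.IsBarrierCandidate) (P : Mat nx nx) {xh : Vec nx}
    (hxh : xh ∈ p.dom) (z : Vec nz) : (p.data (P, xh, z)).1 ≠ 0 :=
  hh.relDegreeOne xh hxh

/-- The input prescribed by the program at uncertainty `P`, estimate `x̂` and output `z`. -/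
noncomputable def optInput (p : Problem nx nu nz) (y : Mat nx nx × Vec nx × Vec nz) : Vec nu :=
  ProgData.sol p.c₁ p.c₂ (p.data y)

theorem isSol_optInput [NeZero nx] (hp : p.Standing) (hh : p.IsBarrierCandidate) (P : Mat nx nx)
    {xh : Vec nx} (hxh : xh ∈ p.dom) (z : Vec nz) :
    ProgData.IsSol p.c₁ p.c₂ (p.data (P, xh, z)) (p.optInput (P, xh, z)) :=
  ProgData.isSol_sol hp.c₁_nonneg hp.c₂_pos.le (data_row_ne_zero hh P hxh z)

theorem exists_unique_minimizer [NeZero nx] (hp : p.Standing) (hh : p.IsBarrierCandidate)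
    {P : Mat nx nx} (hP : P ∈ p.uncertainties) {xh : Vec nx} (hxh : xh ∈ p.dom) (z : Vec nz) :
    ∃! w : Vec nu × ℝ, p.IsMinimizer (minv P) xh z w.1 w.2 := by
  refine ⟨(p.optInput (P, xh, z), max 0 ((p.data (P, xh, z)).lyap (p.optInput (P, xh, z)))),
    (isMinimizer_iff hp hP hxh z _ _).2 ⟨isSol_optInput hp hh P hxh z, rfl⟩, ?_⟩
  rintro ⟨u, δ⟩ hw
  obtain ⟨h1, h2⟩ := (isMinimizer_iff hp hP hxh z u δ).1 hw
  have h3 := h1.unique hp.c₁_nonneg hp.c₂_pos.le (isSol_optInput hp hh P hxh z)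
  subst h3
  rw [h2]

/-- By uniqueness, every controller given by the program is `optInput` along `P`. -/
theorem eq_optInput [NeZero nx] (hp : p.Standing) (hh : p.IsBarrierCandidate)
    {I : Set ℝ} {P : ℝ → Mat nx nx} (hP : p.UniformBounds I P)
    {π : ℝ → Vec nx → Vec nz → Vec nu} (hπ : p.IsProgramController I P π) {t : ℝ} (ht : t ∈ I)
    {xh : Vec nx} (hxh : xh ∈ p.Xhat) (z : Vec nz) : π t xh z = p.optInput (P t, xh, z) := by
  obtain ⟨δ, hδ⟩ := hπ t ht xh hxh z
  have hdom : xh ∈ p.dom := Or.inr hxh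
  exact ((isMinimizer_iff hp (hP t ht) hdom z _ _).1 hδ).1.unique hp.c₁_nonneg hp.c₂_pos.le
    (isSol_optInput hp hh (P t) hdom z)

theorem contDiffAt_data (hp : p.Standing) (hV : p.IsCLF) (hh : p.IsBarrierCandidate)
    {P : Mat nx nx} (hP : P ∈ p.uncertainties) {xh : Vec nx} (hxh : xh ∈ p.dom) (z : Vec nz) :
    ContDiffAt ℝ 1 p.data (P, xh, z) := by
  obtain ⟨D, hD, hsub, hf, hg, hq, hV', hh'⟩ := hp.exists_smooth_domain hV hh
  exact (contDiffOn_data hD hf hg hq hV' hh').contDiffAt ((isOpen_data_domain hD).mem_nhds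
    ⟨isUnit_of_mem_uncertainties hp hP, hsub hxh, trivial⟩)

theorem continuousAt_optInput [NeZero nx] (hp : p.Standing) (hV : p.IsCLF)
    (hh : p.IsBarrierCandidate) {P : Mat nx nx} (hP : P ∈ p.uncertainties) {xh : Vec nx}
    (hxh : xh ∈ p.dom) (z : Vec nz) : ContinuousAt p.optInput (P, xh, z) :=
  (ProgData.continuousAt_sol hp.c₁_nonneg hp.c₂_pos.le (data_row_ne_zero hh P hxh z)).comp
    (contDiffAt_data hp hV hh hP hxh z).continuousAt

theorem piecewiseContinuousOn_controller [NeZero nx] (hp : p.Standing) (hV : p.IsCLF)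
    (hh : p.IsBarrierCandidate) {I : Set ℝ} {P : ℝ → Mat nx nx}
    (hI : ∀ T ∈ I, Icc 0 T ⊆ I)
    (hP : p.UniformBounds I P) (hPc : PiecewiseContinuousOn P I)
    {π : ℝ → Vec nx → Vec nz → Vec nu} (hπ : p.IsProgramController I P π)
    {xh : Vec nx} (hxh : xh ∈ p.Xhat) (z : Vec nz) :
    PiecewiseContinuousOn (fun t => π t xh z) I := by
  have hdom : xh ∈ p.dom := Or.inr hxh
  have heq : EqOn (fun t => p.optInput (P t, xh, z)) (fun t => π t xh z) I := fun t ht =>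
    (eq_optInput hp hh hP hπ ht hxh z).symm
  have hclosed : IsClosed p.uncertainties :=
    (isCompact_Icc_smul_one hp.plow_pos.le hp.phigh_pos).isClosed
  have hlim : ∀ {M : Mat nx nx} {l : Filter ℝ}, I ∈ l → Tendsto P l (𝓝 M) →
      ∃ y, Tendsto (fun t => π t xh z) l (𝓝 y) := by
    intro M l hl hM
    rcases eq_or_neBot l with rfl | hne
    · exact ⟨0, tendsto_bot⟩
    have hMmem : M ∈ p.uncertainties :=
      hclosed.mem_of_tendsto hM (by filter_upwards [hl] with t ht using hP t ht)
    refine ⟨p.optInput (M, xh, z), Tendsto.congr' (eventuallyEq_of_mem hl heq) ?_⟩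
    exact (continuousAt_optInput hp hV hh hMmem hdom z).tendsto.comp
      (hM.prodMk_nhds tendsto_const_nhds)
  intro T hT
  obtain ⟨⟨F, hF⟩, hside⟩ := hPc T hT
  refine ⟨⟨F, fun t ht htF => ?_⟩, fun t ht => ?_⟩
  · have htI := hI T hT ht
    have h1 : ContinuousWithinAt (fun t => p.optInput (P t, xh, z)) I t :=
      ContinuousAt.comp_continuousWithinAt (f := fun t => (P t, xh, z))
        (continuousAt_optInput hp hV hh (hP t htI) hdom z)
        ((hF t ht htF).prodMk continuousWithinAt_const)
    exact h1.congr (fun s hs => (heq hs).symm) (heq htI).symm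
  · obtain ⟨⟨M₁, h1⟩, M₂, h2⟩ := hside t ht
    exact ⟨hlim (mem_of_superset self_mem_nhdsWithin inter_subset_left) h1,
      hlim (mem_of_superset self_mem_nhdsWithin inter_subset_left) h2⟩

theorem lipschitzOnWith_controller [NeZero nx] (hp : p.Standing) (hV : p.IsCLF)
    (hh : p.IsBarrierCandidate) {I J : Set ℝ} {P : ℝ → Mat nx nx}
    (hP : p.UniformBounds I P) {π : ℝ → Vec nx → Vec nz → Vec nu}
    (hπ : p.IsProgramController I P π) {Z : Set (Vec nz)} (hJ : IsCompact J) (hJI : J ⊆ I)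
    (hPJ : ContinuousOn P J) (hZ : IsCompact Z) (hdist : p.DistinctConfidence J Z P π) :
    ∃ L : ℝ≥0, ∀ t ∈ J,
      LipschitzOnWith L (fun y : Vec nx × Vec nz => π t y.1 y.2) (p.Xhat ×ˢ Z) := by
  set K : Set (Mat nx nx × Vec nx × Vec nz) := (P '' J) ×ˢ p.Xhat ×ˢ Z with hK
  have hKc : IsCompact K := (hJ.image_of_continuousOn hPJ).prod (hp.compact_Xhat.prod hZ)
  have hKu : ∀ y ∈ K, y.1 ∈ p.uncertainties := by
    rintro ⟨M, xh, z⟩ ⟨⟨t, ht, rfl⟩, -⟩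
    exact hP t (hJI ht)
  have hKd : ∀ y ∈ K, y.2.1 ∈ p.dom := fun y hy => Or.inr hy.2.1
  have hdata : ∀ y ∈ K, ContDiffAt ℝ 1 p.data y := fun y hy =>
    contDiffAt_data hp hV hh (hKu y hy) (hKd y hy) y.2.2
  have hdc : ContinuousOn p.data K := fun y hy => (hdata y hy).continuousAt.continuousWithinAt
  have huc : ContinuousOn p.optInput K := fun y hy =>
    (continuousAt_optInput hp hV hh (hKu y hy) (hKd y hy) y.2.2).continuousWithinAt
  obtain ⟨L₁, hL₁⟩ : ∃ L₁ : ℝ≥0, LipschitzOnWith L₁ p.data K := by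
    refine LocallyLipschitzOn.exists_lipschitzOnWith_of_compact
      (β := ProgData (Vec nu) (Vec nx)) (f := p.data) hKc fun y hy => ?_
    obtain ⟨L, t, ht, h⟩ := (hdata y hy).exists_lipschitzOnWith
    exact ⟨L, t, mem_nhdsWithin_of_mem_nhds ht, h⟩
  obtain ⟨B₁, hB₁⟩ := hKc.exists_bound_of_continuousOn (E := ProgData (Vec nu) (Vec nx)) hdc
  obtain ⟨B₂, hB₂⟩ := hKc.exists_bound_of_continuousOn huc
  obtain ⟨r, hr, hrK⟩ : ∃ r > 0, ∀ y ∈ K, r ≤ ‖(p.data y).1‖ := by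
    rcases K.eq_empty_or_nonempty with h | h
    · exact ⟨1, one_pos, by simp [h]⟩
    · obtain ⟨y, hy, hmin⟩ := hKc.exists_isMinOn h (f := fun y => ‖(p.data y).1‖)
        (continuous_fst.comp_continuousOn hdc).norm
      exact ⟨_, norm_pos_iff.2 (data_row_ne_zero hh y.1 (hKd y hy) y.2.2), fun z hz => hmin hz⟩
  obtain ⟨g, hg, hgK⟩ : ∃ g > 0, ∀ M ∈ (fun y => (p.data y).mat (p.optInput y)) '' K,
      HasGap M g := by
    have hmc : ContinuousOn (fun y => (p.data y).mat (p.optInput y)) K :=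
      Continuous.comp_continuousOn (g := fun w : ProgData (Vec nu) (Vec nx) × Vec nu => w.1.mat w.2)
        (f := fun y => (p.data y, p.optInput y)) ProgData.continuous_mat (hdc.prodMk huc)
    refine exists_hasGap (hKc.image_of_continuousOn hmc) ?_ ?_
    · rintro _ ⟨⟨M, xh, z⟩, hy, rfl⟩
      exact isSelfAdjoint_mat_data hp (hKu _ hy) (hKd _ hy) z _
    · rintro _ ⟨⟨M, xh, z⟩, hy, rfl⟩
      have hg := differentiableAt_g hp (hKd _ hy)
      obtain ⟨⟨t, ht, rfl⟩, hxh, hz⟩ := hy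
      have h := (hdist t ht).2 xh hxh z hz
      rw [eq_optInput hp hh hP hπ (hJI ht) hxh z, ← mat_data hg (P t) z] at h
      exact h
  obtain ⟨L, hL0, hL⟩ := ProgData.exists_lipschitz (U := Vec nu) (H := Vec nx) hp.c₁_nonneg
    hp.c₂_pos.le (le_max_left 1 (max B₁ B₂)) hg hr
  refine ⟨L.toNNReal * L₁, fun t ht => LipschitzOnWith.of_dist_le_mul ?_⟩
  rintro ⟨xh, z⟩ ⟨hxh, hz⟩ ⟨xh', z'⟩ ⟨hxh', hz'⟩
  have hm : (P t, xh, z) ∈ K := ⟨⟨t, ht, rfl⟩, hxh, hz⟩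
  have hm' : (P t, xh', z') ∈ K := ⟨⟨t, ht, rfl⟩, hxh', hz'⟩
  have hb₁ : ∀ y ∈ K, ‖p.data y‖ ≤ max 1 (max B₁ B₂) := fun y hy =>
    (hB₁ y hy).trans ((le_max_left _ _).trans (le_max_right _ _))
  have hb₂ : ∀ y ∈ K, ‖p.optInput y‖ ≤ max 1 (max B₁ B₂) := fun y hy =>
    (hB₂ y hy).trans ((le_max_right _ _).trans (le_max_right _ _))
  have h1 := hL _ _ _ _ (hb₁ _ hm) (hb₁ _ hm') (hb₂ _ hm) (hb₂ _ hm') (hrK _ hm) (hrK _ hm')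
    (hgK _ ⟨_, hm, rfl⟩) (hgK _ ⟨_, hm', rfl⟩)
    (isSol_optInput hp hh (P t) (hKd _ hm) z) (isSol_optInput hp hh (P t) (hKd _ hm') z')
  have h2 := LipschitzOnWith.dist_le_mul (β := ProgData (Vec nu) (Vec nx)) hL₁ _ hm _ hm'
  have h3 : dist (P t, xh, z) (P t, xh', z') = dist (xh, z) (xh', z') := by
    rw [Prod.dist_eq, dist_self]
    exact max_eq_right dist_nonneg
  rw [h3] at h2
  have h4 : ‖p.data (P t, xh, z) - p.data (P t, xh', z')‖ ≤ L₁ * dist (xh, z) (xh', z') :=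
    (dist_eq_norm (p.data (P t, xh, z)) (p.data (P t, xh', z'))).symm.trans_le h2
  show dist (π t xh z) (π t xh' z') ≤ _
  rw [eq_optInput hp hh hP hπ (hJI ht) hxh z, eq_optInput hp hh hP hπ (hJI ht) hxh' z',
    dist_eq_norm, NNReal.coe_mul, Real.coe_toNNReal _ hL0, mul_assoc]
  exact h1.trans (mul_le_mul_of_nonneg_left h4 hL0)

end Problem

/-! ### Quadratic bound of the linearization error -/

/-- On a compact set, convex or not, the error of the first-order expansion of a `C²` function is
quadratic: near the diagonal by the mean value inequality, away from it because it is bounded. -/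
theorem exists_linearization_bound {E F : Type*} [NormedAddCommGroup E] [NormedSpace ℝ E]
    [NormedAddCommGroup F] [NormedSpace ℝ F] {φ : E → F} {K : Set E} (hK : IsCompact K)
    (hφ : IsC2On φ K) :
    ∃ c, 0 ≤ c ∧ ∀ x ∈ K, ∀ y ∈ K, ‖φ x - φ y - fderiv ℝ φ y (x - y)‖ ≤ c * ‖x - y‖ ^ 2 := by
  obtain ⟨D, hD, hKD, hφ⟩ := hφ
  have hcont : ContinuousOn φ K := (hφ.continuousOn).mono hKD
  have hfd : ContDiffOn ℝ 1 (fderiv ℝ φ) D := hφ.fderiv_of_isOpen hD (by norm_num)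
  have hfdc : ContinuousOn (fderiv ℝ φ) K := hfd.continuousOn.mono hKD
  let R : E × E → ℝ := fun w => ‖φ w.1 - φ w.2 - fderiv ℝ φ w.2 (w.1 - w.2)‖
  have hR : ContinuousOn R (K ×ˢ K) := by
    have h1 : ContinuousOn (fun w : E × E => φ w.1) (K ×ˢ K) :=
      hcont.comp continuousOn_fst fun w hw => hw.1
    have h2 : ContinuousOn (fun w : E × E => φ w.2) (K ×ˢ K) :=
      hcont.comp continuousOn_snd fun w hw => hw.2
    have h3 : ContinuousOn (fun w : E × E => fderiv ℝ φ w.2) (K ×ˢ K) :=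
      hfdc.comp continuousOn_snd fun w hw => hw.2
    exact ((h1.sub h2).sub (h3.clm_apply (continuousOn_fst.sub continuousOn_snd))).norm
  have key : ∃ c, 0 ≤ c ∧ ∀ w ∈ K ×ˢ K, R w ≤ c * ‖w.1 - w.2‖ ^ 2 := by
    refine (hK.prod hK).induction_on (p := fun s => ∃ c, 0 ≤ c ∧ ∀ w ∈ s, R w ≤ c * ‖w.1 - w.2‖ ^ 2)
      ⟨0, le_rfl, by simp⟩ ?_ ?_ ?_
    · rintro s t hst ⟨c, hc, h⟩
      exact ⟨c, hc, fun w hw => h w (hst hw)⟩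
    · rintro s t ⟨c, hc, h⟩ ⟨c', hc', h'⟩
      refine ⟨max c c', hc.trans (le_max_left _ _), ?_⟩
      rintro w (hw | hw)
      · exact (h w hw).trans (by gcongr; exact le_max_left _ _)
      · exact (h' w hw).trans (by gcongr; exact le_max_right _ _)
    · rintro ⟨x, y⟩ ⟨hx, hy⟩
      rcases eq_or_ne x y with rfl | hne
      · have hxD := hD.mem_nhds (hKD hx)
        obtain ⟨L, t, ht, hL⟩ := (hfd.contDiffAt hxD).exists_lipschitzOnWith
        obtain ⟨r, hr, hball⟩ := Metric.mem_nhds_iff.1 (inter_mem ht hxD)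
        refine ⟨Metric.ball x r ×ˢ Metric.ball x r, mem_nhdsWithin_of_mem_nhds
          (prod_mem_nhds (Metric.ball_mem_nhds x hr) (Metric.ball_mem_nhds x hr)),
          L, L.2, ?_⟩
        rintro ⟨z, w⟩ ⟨hz, hw⟩
        have hseg : segment ℝ w z ⊆ Metric.ball x r := (convex_ball x r).segment_subset hw hz
        have := (convex_segment w z).norm_image_sub_le_of_norm_hasFDerivWithin_le'
          (f := φ) (f' := fderiv ℝ φ) (φ := fderiv ℝ φ w) (C := L * ‖z - w‖) (fun u hu =>
            ((hφ.contDiffAt (hD.mem_nhds (hball (hseg hu)).2)).differentiableAt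
              two_ne_zero).hasFDerivAt.hasFDerivWithinAt)
          (fun u hu => by
            have h1 := hL.dist_le_mul u (hball (hseg hu)).1 w (hball hw).1
            rw [dist_eq_norm, dist_eq_norm] at h1
            exact h1.trans (by gcongr; exact norm_sub_le_of_mem_segment hu))
          (left_mem_segment ℝ w z) (right_mem_segment ℝ w z)
        calc R (z, w) ≤ L * ‖z - w‖ * ‖z - w‖ := this
          _ = L * ‖z - w‖ ^ 2 := by ring
      · have hpos : 0 < ‖x - y‖ := norm_pos_iff.2 (sub_ne_zero.2 hne)
        have hn : ContinuousWithinAt (fun w : E × E => ‖w.1 - w.2‖) (K ×ˢ K) (x, y) := by fun_prop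
        refine ⟨_, inter_mem ((hR (x, y) ⟨hx, hy⟩).eventually (gt_mem_nhds (lt_add_one _)))
          (hn.eventually (lt_mem_nhds (half_lt_self hpos))),
          (R (x, y) + 1) / (‖x - y‖ / 2) ^ 2, ?_, ?_⟩
        · have : 0 ≤ R (x, y) := norm_nonneg _
          positivity
        · rintro w ⟨hw1, hw2⟩
          have h0 : 0 ≤ R (x, y) := norm_nonneg _
          have hw1 : R w < R (x, y) + 1 := hw1
          have hw2 : ‖x - y‖ / 2 < ‖w.1 - w.2‖ := hw2
          rw [div_mul_eq_mul_div, le_div_iff₀ (by positivity)]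
          gcongr
  obtain ⟨c, hc, h⟩ := key
  exact ⟨c, hc, fun x hx y hy => h (x, y) ⟨hx, hy⟩⟩

/-! ### Time intervals and comparison -/

theorem Icc_subset_timeInterval {tmax : EReal} {T : ℝ} (hT : T ∈ timeInterval tmax) :
    Icc 0 T ⊆ timeInterval tmax := fun _ ht =>
  ⟨ht.1, (EReal.coe_le_coe_iff.2 ht.2).trans_lt hT.2⟩

theorem HasDerivWithinAt.Ici_of_timeInterval {F : Type*} [NormedAddCommGroup F] [NormedSpace ℝ F]
    {tmax : EReal} {φ : ℝ → F} {φ' : F} {t T : ℝ} (hT : T ∈ timeInterval tmax) (ht : t ∈ Ico 0 T)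
    (h : HasDerivWithinAt φ φ' (timeInterval tmax) t) : HasDerivWithinAt φ φ' (Ici t) t := by
  refine h.mono_of_mem_nhdsWithin ?_
  filter_upwards [Icc_mem_nhdsGE ht.2] with s hs
  exact Icc_subset_timeInterval hT ⟨ht.1.trans hs.1, hs.2⟩

/-- Exponential decay of a function that decays strictly at rate `β` as long as it is positive and
at most `w`, and starts below `w`. -/
theorem le_mul_exp_of_deriv_lt {tmax : EReal} {W W' : ℝ → ℝ} {β w : ℝ} (hβ : 0 ≤ β)
    (hW : ∀ t ∈ timeInterval tmax, HasDerivWithinAt W (W' t) (timeInterval tmax) t)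
    (hdecay : ∀ t ∈ timeInterval tmax, 0 < W t → W t ≤ w → W' t < -β * W t)
    (h0 : 0 ≤ W 0) (hw : W 0 < w) :
    ∀ t ∈ timeInterval tmax, W t ≤ W 0 * Real.exp (-β * t) := by
  intro T hT
  have key : ∀ s ∈ Ioo (W 0) w, W T ≤ s * Real.exp (-β * T) := by
    intro s hs
    have hs0 : 0 < s := h0.trans_lt hs.1
    have hsub := Icc_subset_timeInterval hT
    refine image_le_of_deriv_right_lt_deriv_boundary (f := W) (f' := W') (a := 0) (b := T)
      (B := fun t => s * Real.exp (-β * t)) (B' := fun t => -β * (s * Real.exp (-β * t)))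
      (fun t ht => (hW t (hsub ht)).continuousWithinAt.mono hsub)
      (fun t ht => (hW t (hsub (Ico_subset_Icc_self ht))).Ici_of_timeInterval hT ht)
      (by simpa using hs.1.le) (fun t => ?_) (fun t ht hWB => ?_) ⟨hT.1, le_rfl⟩
    · have h1 : HasDerivAt (fun t : ℝ => -β * t) (-β) t := by
        simpa using (hasDerivAt_id t).const_mul (-β)
      exact (h1.exp.const_mul s).congr_deriv (by ring)
    · have h1 : Real.exp (-β * t) ≤ 1 := Real.exp_le_one_iff.2 (by nlinarith [ht.1])
      rw [← hWB]
      refine hdecay t (hsub (Ico_subset_Icc_self ht)) (by rw [hWB]; positivity) ?_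
      rw [hWB]
      exact (mul_le_of_le_one_right hs0.le h1).trans hs.2.le
  have hlim : Tendsto (fun s : ℝ => s * Real.exp (-β * T)) (𝓝[>] (W 0))
      (𝓝 (W 0 * Real.exp (-β * T))) :=
    ((continuous_id.mul continuous_const).tendsto (W 0)).mono_left nhdsWithin_le_nhds
  refine ge_of_tendsto hlim ?_
  filter_upwards [Ioo_mem_nhdsGT hw] with s hs using key s hs

/-! ### The estimation error -/

namespace Problem

variable {nx nu nz : ℕ} {p : Problem nx nu nz}

/-- Remainder of the linearized error dynamics at state `x`, estimate `x̂` and input `u`. -/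
noncomputable def remainder (p : Problem nx nu nz) (P : Mat nx nx) (x xh : Vec nx) (u : Vec nu) :
    Vec nx :=
  (p.f x - p.f xh - fderiv ℝ p.f xh (x - xh)) + (p.g x - p.g xh - fderiv ℝ p.g xh (x - xh)) u
    - p.gain (minv P) xh (p.q x - p.q xh - p.C xh (x - xh))

/-- The error dynamics: the terms with `A` cancel against the Riccati equation, which leaves the
weights `κ`, `R`, `Q` and the remainder of the linearization. -/
theorem lyapunov_rate_eq (hp : p.Standing) {P : Mat nx nx} (hP : P ∈ p.uncertainties)
    {x xh : Vec nx} (hxh : xh ∈ p.dom) (u : Vec nu) {ω : Vec nx} (hω : P ω = x - xh) :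
    -⟪p.riccati P xh u ω, ω⟫_ℝ + 2 * ⟪ω, (p.f x + p.g x u)
        - (p.f xh + p.g xh u + p.gain (minv P) xh (p.q x - p.q xh))⟫_ℝ
      = -p.κ * ⟪ω, x - xh⟫_ℝ
        - ⟪minv p.R (p.C xh (x - xh)), p.C xh (x - xh)⟫_ℝ - ⟪p.Q ω, ω⟫_ℝ
        + 2 * ⟪ω, p.remainder P x xh u⟫_ℝ := by
  have hunit := isUnit_of_mem_uncertainties hp hP
  have hsym : ∀ v w, ⟪P v, w⟫_ℝ = ⟪v, P w⟫_ℝ := (mem_Icc_smul_one_iff.1 hP).1.isSymmetric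
  set ζ := x - xh with hζ
  have h1 : ⟪p.riccati P xh u ω, ω⟫_ℝ = p.κ * ⟪ω, ζ⟫_ℝ + 2 * ⟪ω, p.A xh u ζ⟫_ℝ
      - ⟪minv p.R (p.C xh ζ), p.C xh ζ⟫_ℝ + ⟪p.Q ω, ω⟫_ℝ := by
    simp only [riccati, add_apply, sub_apply, smul_apply, ContinuousLinearMap.comp_apply, hω,
      inner_add_left, inner_sub_left, real_inner_smul_left, hsym,
      ContinuousLinearMap.adjoint_inner_left]
    rw [real_inner_comm ζ ω, real_inner_comm (p.A xh u ζ) ω]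
    ring
  have h2 : (p.f x + p.g x u) - (p.f xh + p.g xh u + p.gain (minv P) xh (p.q x - p.q xh))
      = p.A xh u ζ - P (transp (p.C xh) (minv p.R (p.C xh ζ))) + p.remainder P x xh u := by
    simp only [hζ, remainder, A_eq (differentiableAt_g hp hxh), gain, minv_minv hunit, add_apply,
      sub_apply, ContinuousLinearMap.comp_apply, ContinuousLinearMap.flip_apply, map_sub]
    abel
  have h3 : ⟪ω, P (transp (p.C xh) (minv p.R (p.C xh ζ)))⟫_ℝ
      = ⟪minv p.R (p.C xh ζ), p.C xh ζ⟫_ℝ := by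
    rw [← hsym, hω, ContinuousLinearMap.adjoint_inner_right, real_inner_comm]
  rw [h1, h2, inner_add_right, inner_sub_right ω (p.A xh u ζ), h3]
  ring

theorem hasDerivWithinAt_lyapunov {I : Set ℝ} {t : ℝ} {P : ℝ → Mat nx nx} {P' : Mat nx nx}
    {ζ : ℝ → Vec nx} {ζ' : Vec nx} (hP : HasDerivWithinAt P P' I t)
    (hζ : HasDerivWithinAt ζ ζ' I t) (hu : IsUnit (P t)) (hsa : IsSelfAdjoint (P t)) :
    HasDerivWithinAt (fun s => ⟪minv (P s) (ζ s), ζ s⟫_ℝ)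
      (-⟪P' (minv (P t) (ζ t)), minv (P t) (ζ t)⟫_ℝ + 2 * ⟪minv (P t) (ζ t), ζ'⟫_ℝ) I t := by
  have hS : HasDerivWithinAt (fun s => minv (P s)) (-(minv (P t) * P' * minv (P t))) I t := by
    obtain ⟨w, hw⟩ := hu
    have h1 := hasFDerivAt_ringInverse (𝕜 := ℝ) w
    rw [hw] at h1
    have h2 := h1.comp_hasDerivWithinAt t hP
    simp only [minv_eq_ringInverse]
    refine h2.congr_deriv ?_
    rw [← hw, Ring.inverse_unit]
    simp
  have hsym : ∀ v w, ⟪minv (P t) v, w⟫_ℝ = ⟪v, minv (P t) w⟫_ℝ :=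
    (isSelfAdjoint_minv hsa).isSymmetric
  refine ((hS.clm_apply hζ).inner ℝ hζ).congr_deriv ?_
  have h1 := hsym (P' (minv (P t) (ζ t))) (ζ t)
  have h2 : ⟪minv (P t) ζ', ζ t⟫_ℝ = ⟪minv (P t) (ζ t), ζ'⟫_ℝ := by
    rw [hsym, real_inner_comm]
  simp only [neg_apply, mul_apply_eq_comp, inner_add_left, inner_neg_left, h1, h2]
  ring


theorem gain_eq (hp : p.Standing) {P : Mat nx nx} (hP : P ∈ p.uncertainties) (xh : Vec nx) :
    p.gain (minv P) xh = P ∘L transp (p.C xh) ∘L minv p.R := by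
  rw [gain, minv_minv (isUnit_of_mem_uncertainties hp hP)]

theorem exists_remainder_bound [NeZero nx] (hp : p.Standing) (hV : p.IsCLF)
    (hh : p.IsBarrierCandidate) : ∃ c, 0 ≤ c ∧ ∀ P ∈ p.uncertainties, ∀ x ∈ p.X, ∀ xh ∈ p.Xhat,
      ‖p.remainder P x xh (p.optInput (P, xh, p.q x))‖ ≤ c * ‖x - xh‖ ^ 2 := by
  have hdom : IsCompact p.dom := hp.compact_X.union hp.compact_Xhat
  obtain ⟨cf, hcf, hf⟩ := exists_linearization_bound hdom hp.smooth_f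
  obtain ⟨cg, hcg, hg⟩ := exists_linearization_bound hdom hp.smooth_g
  obtain ⟨cq, hcq, hq⟩ := exists_linearization_bound hdom hp.smooth_q
  obtain ⟨D, hD, hsub, -, -, hqD, -, -⟩ := hp.exists_smooth_domain hV hh
  have hXh : p.Xhat ⊆ D := subset_union_right.trans hsub
  have hunc : IsCompact p.uncertainties := isCompact_Icc_smul_one hp.plow_pos.le hp.phigh_pos
  have hqX : IsCompact (p.q '' p.X) :=
    hp.compact_X.image_of_continuousOn (hqD.continuousOn.mono (subset_union_left.trans hsub))
  obtain ⟨Bu, hBu⟩ := (hunc.prod (hp.compact_Xhat.prod hqX)).exists_bound_of_continuousOn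
    (f := p.optInput) fun y hy =>
      (continuousAt_optInput hp hV hh hy.1 (Or.inr hy.2.1) y.2.2).continuousWithinAt
  have hCc : ContinuousOn (fun xh => transp (p.C xh) ∘L minv p.R) p.Xhat := by
    have h1 : ContinuousOn p.C p.Xhat :=
      (hqD.continuousOn_fderiv_of_isOpen hD one_le_two).mono hXh
    exact ((transpL nz nx).continuous.comp_continuousOn h1).clm_comp continuousOn_const
  obtain ⟨BK, hBK⟩ := hp.compact_Xhat.exists_bound_of_continuousOn hCc
  refine ⟨cf + cg * |Bu| + p.phigh * (|BK| * cq), by have := hp.phigh_pos; positivity,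
    fun P hP x hx xh hxh => ?_⟩
  have hx' : x ∈ p.dom := Or.inl hx
  have hxh' : xh ∈ p.dom := Or.inr hxh
  set u := p.optInput (P, xh, p.q x)
  have hu : ‖u‖ ≤ |Bu| := (hBu (P, xh, p.q x) ⟨hP, hxh, x, hx, rfl⟩).trans (le_abs_self _)
  have h1 := hf x hx' xh hxh'
  have h2 : ‖(p.g x - p.g xh - fderiv ℝ p.g xh (x - xh)) u‖ ≤ cg * ‖x - xh‖ ^ 2 * |Bu| :=
    (ContinuousLinearMap.le_opNorm _ _).trans
      (mul_le_mul (hg x hx' xh hxh') hu (norm_nonneg _) (by positivity))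
  have h3 : ‖p.gain (minv P) xh (p.q x - p.q xh - p.C xh (x - xh))‖
      ≤ p.phigh * (|BK| * (cq * ‖x - xh‖ ^ 2)) := by
    have hphigh := hp.phigh_pos
    rw [gain_eq hp hP]
    refine (norm_apply_le_of_mem_Icc hp.plow_pos.le hp.phigh_pos hP _).trans ?_
    gcongr
    exact ((transp (p.C xh) ∘L minv p.R).le_opNorm _).trans
      (mul_le_mul ((hBK xh hxh).trans (le_abs_self _)) (hq x hx' xh hxh') (norm_nonneg _)
        (abs_nonneg _))
  refine (norm_sub_le _ _).trans ((add_le_add ((norm_add_le _ _).trans (add_le_add h1 h2)) h3).trans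
    (le_of_eq (by ring)))

/-- The Lyapunov function `⟪P⁻¹ ζ, ζ⟫` of the error `ζ`: the weight `Q` contributes a decay beyond
the rate `κ`, which dominates the cubic contribution of the remainder while the error is small. -/
theorem exists_errorBound [NeZero nx] (hp : p.Standing) (hV : p.IsCLF)
    (hh : p.IsBarrierCandidate) : ∃ ε η θ : ℝ, 0 < ε ∧ 0 < η ∧ p.κ / 2 < θ ∧
      ∀ (tmax : EReal) (P : ℝ → Mat nx nx) (π : ℝ → Vec nx → Vec nz → Vec nu)
        (x xh : ℝ → Vec nx), 0 < tmax →
        p.UniformBounds (timeInterval tmax) P →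
        p.IsProgramController (timeInterval tmax) P π →
        p.ClosedLoop (timeInterval tmax) P π x xh →
        ErrorBound (timeInterval tmax) ε η θ x xh := by
  obtain ⟨c, hc, hrem⟩ := exists_remainder_bound hp hV hh
  obtain ⟨a, ha, hQ⟩ := hp.Q_pos.exists_lower_bound
  have hlow := hp.plow_pos
  have hhigh := hp.phigh_pos
  have hκ := hp.κ_nonneg
  set m := a / (4 * p.phigh) with hm
  set ρ := a / (4 * (c + 1) * p.phigh) with hρ
  have hmpos : 0 < m := by positivity
  have hρpos : 0 < ρ := by positivity
  refine ⟨ρ * p.plow / p.phigh, p.phigh / p.plow, (p.κ + m) / 2, by positivity, by positivity,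
    by linarith, fun tmax P π x xh htmax hP hπ hcl hsmall => ?_⟩
  set I := timeInterval tmax with hI
  have h0I : (0 : ℝ) ∈ I := ⟨le_rfl, by simpa using htmax⟩
  let ζ : ℝ → Vec nx := fun t => x t - xh t
  let ω : ℝ → Vec nx := fun t => minv (P t) (ζ t)
  let u : ℝ → Vec nu := fun t => π t (xh t) (p.q (x t))
  let W : ℝ → ℝ := fun t => ⟪ω t, ζ t⟫_ℝ
  let W' : ℝ → ℝ := fun t => -⟪p.riccati (P t) (xh t) (u t) (ω t), ω t⟫_ℝ
    + 2 * ⟪ω t, (p.f (x t) + p.g (x t) (u t)) - (p.f (xh t) + p.g (xh t) (u t)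
      + p.gain (minv (P t)) (xh t) (p.q (x t) - p.q (xh t)))⟫_ℝ
  have hPω : ∀ t ∈ I, P t (ω t) = ζ t := fun t ht =>
    apply_minv_apply (isUnit_of_mem_uncertainties hp (hP t ht)) _
  have hderiv : ∀ t ∈ I, HasDerivWithinAt W (W' t) I t := fun t ht =>
    hasDerivWithinAt_lyapunov (hcl.uncertainty t ht) ((hcl.plant t ht).sub (hcl.observer t ht))
      (isUnit_of_mem_uncertainties hp (hP t ht)) (mem_Icc_smul_one_iff.1 (hP t ht)).1
  -- norm equivalences between `ζ`, `ω` and `W`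
  have hWω : ∀ t ∈ I, p.plow * ‖ω t‖ ^ 2 ≤ W t ∧ W t ≤ p.phigh * ‖ω t‖ ^ 2 := fun t ht => by
    have h := (mem_Icc_smul_one_iff.1 (hP t ht)).2 (ω t)
    rwa [hPω t ht, real_inner_comm] at h
  have hζω : ∀ t ∈ I, ‖ζ t‖ ≤ p.phigh * ‖ω t‖ := fun t ht => by
    have h := norm_apply_le_of_mem_Icc hp.plow_pos.le hp.phigh_pos (hP t ht) (ω t)
    rwa [hPω t ht] at h
  have hζW : ∀ t ∈ I, p.plow * ‖ζ t‖ ^ 2 ≤ p.phigh ^ 2 * W t := fun t ht => by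
    have h1 := pow_le_pow_left₀ (norm_nonneg _) (hζω t ht) 2
    have h2 := mul_le_mul_of_nonneg_left (hWω t ht).1 (sq_nonneg p.phigh)
    have h3 := mul_le_mul_of_nonneg_left h1 hlow.le
    linarith
  have hWζ : ∀ t ∈ I, p.plow * W t ≤ ‖ζ t‖ ^ 2 := fun t ht => by
    have h1 : W t ≤ ‖ω t‖ * ‖ζ t‖ := real_inner_le_norm _ _
    have h2 : p.plow * ‖ω t‖ ≤ ‖ζ t‖ := by
      rcases (norm_nonneg (ω t)).eq_or_lt with h | h
      · rw [← h, mul_zero]; exact norm_nonneg _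
      · refine le_of_mul_le_mul_right ?_ h
        linarith [(hWω t ht).1]
    have h3 := mul_le_mul_of_nonneg_left h1 hlow.le
    have h4 := mul_le_mul_of_nonneg_right h2 (norm_nonneg (ζ t))
    linarith
  have hdecay : ∀ t ∈ I, 0 < W t → W t ≤ ρ ^ 2 * p.plow / p.phigh ^ 2 →
      W' t < -(p.κ + m) * W t := by
    intro t ht hWpos hWle
    have hζρ : ‖ζ t‖ ≤ ρ := by
      refine (pow_le_pow_iff_left₀ (norm_nonneg _) hρpos.le two_ne_zero).1 ?_
      refine le_of_mul_le_mul_left ((hζW t ht).trans ?_) hlow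
      rw [le_div_iff₀ (by positivity)] at hWle
      linarith
    have h1 : W' t = -p.κ * W t
        - ⟪minv p.R (p.C (xh t) (ζ t)), p.C (xh t) (ζ t)⟫_ℝ - ⟪p.Q (ω t), ω t⟫_ℝ
        + 2 * ⟪ω t, p.remainder (P t) (x t) (xh t) (u t)⟫_ℝ :=
      lyapunov_rate_eq hp (hP t ht) (Or.inr (hcl.estimate_mem t ht)) (u t) (hPω t ht)
    have h2 := hp.R_pos.minv_inner_nonneg (p.C (xh t) (ζ t))
    have h3 := hQ (ω t)
    have h4 : ‖p.remainder (P t) (x t) (xh t) (u t)‖ ≤ c * ‖ζ t‖ ^ 2 := by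
      have h := hrem (P t) (hP t ht) (x t) (hcl.state_mem t ht) (xh t) (hcl.estimate_mem t ht)
      rwa [← eq_optInput hp hh hP hπ ht (hcl.estimate_mem t ht)] at h
    have h5 : ⟪ω t, p.remainder (P t) (x t) (xh t) (u t)⟫_ℝ
        ≤ ‖ω t‖ * (c * (ρ * (p.phigh * ‖ω t‖))) := by
      refine (real_inner_le_norm _ _).trans ?_
      gcongr
      refine h4.trans ?_
      rw [sq]
      gcongr
      exact hζω t ht
    have h6 : c * ρ * p.phigh ≤ a / 4 := by
      have e : (c + 1) * ρ * p.phigh = a / 4 := by rw [hρ]; field_simp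
      have : 0 ≤ ρ * p.phigh := by positivity
      linarith
    have h7 : ‖ω t‖ * (c * (ρ * (p.phigh * ‖ω t‖))) ≤ a / 4 * ‖ω t‖ ^ 2 := by
      have := mul_le_mul_of_nonneg_right h6 (sq_nonneg ‖ω t‖)
      linarith
    have h8 : 2 * m * W t ≤ a / 2 * ‖ω t‖ ^ 2 := by
      have h := mul_le_mul_of_nonneg_left (hWω t ht).2 (by positivity : 0 ≤ 2 * m)
      have e : 2 * m * (p.phigh * ‖ω t‖ ^ 2) = a / 2 * ‖ω t‖ ^ 2 := by
        rw [hm]; field_simp; ring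
      linarith
    have h9 := mul_pos hmpos hWpos
    rw [h1]
    linarith
  have hW0 : 0 ≤ W 0 := le_trans (by positivity) (hWω 0 h0I).1
  have hW0lt : W 0 < ρ ^ 2 * p.plow / p.phigh ^ 2 := by
    have h1 : ‖ζ 0‖ ^ 2 < (ρ * p.plow / p.phigh) ^ 2 :=
      pow_lt_pow_left₀ hsmall (norm_nonneg _) two_ne_zero
    refine lt_of_mul_lt_mul_left ((hWζ 0 h0I).trans_lt (h1.trans_eq ?_)) hlow.le
    ring
  have hexp := le_mul_exp_of_deriv_lt (by linarith) hderiv hdecay hW0 hW0lt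
  intro t ht
  show ‖ζ t‖ ≤ p.phigh / p.plow * ‖ζ 0‖ * Real.exp (-((p.κ + m) / 2) * t)
  refine (pow_le_pow_iff_left₀ (norm_nonneg _) (by positivity) two_ne_zero).1 ?_
  have hee : Real.exp (-((p.κ + m) / 2) * t) ^ 2 = Real.exp (-(p.κ + m) * t) := by
    rw [← Real.exp_nat_mul]; congr 1; push_cast; ring
  rw [mul_pow, mul_pow, hee, div_pow, div_mul_eq_mul_div, div_mul_eq_mul_div,
    le_div_iff₀ (by positivity)]
  calc ‖ζ t‖ ^ 2 * p.plow ^ 2 = p.plow * (p.plow * ‖ζ t‖ ^ 2) := by ring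
    _ ≤ p.plow * (p.phigh ^ 2 * (W 0 * Real.exp (-(p.κ + m) * t))) := by
        exact mul_le_mul_of_nonneg_left ((hζW t ht).trans
          (mul_le_mul_of_nonneg_left (hexp t ht) (sq_nonneg _))) hlow.le
    _ = p.phigh ^ 2 * (p.plow * W 0) * Real.exp (-(p.κ + m) * t) := by ring
    _ ≤ p.phigh ^ 2 * ‖ζ 0‖ ^ 2 * Real.exp (-(p.κ + m) * t) := by
        gcongr
        exact hWζ 0 h0I

end Problem

/-! ### Safety -/

theorem mul_exp_le_of_deriv_ge {tmax : EReal} {y y' : ℝ → ℝ} {α : ℝ}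
    (hy : ∀ t ∈ timeInterval tmax, HasDerivWithinAt y (y' t) (timeInterval tmax) t)
    (hge : ∀ t ∈ timeInterval tmax, -α * y t ≤ y' t) :
    ∀ t ∈ timeInterval tmax, y 0 * Real.exp (-α * t) ≤ y t := by
  intro T hT
  have hsub := Icc_subset_timeInterval hT
  have hF : ∀ t ∈ timeInterval tmax, HasDerivWithinAt (fun s => -(y s * Real.exp (α * s)))
      (-((y' t + α * y t) * Real.exp (α * t))) (timeInterval tmax) t := fun t ht => by
    have h1 : HasDerivAt (fun t : ℝ => α * t) α t := by
      simpa using (hasDerivAt_id t).const_mul α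
    exact ((hy t ht).mul h1.exp.hasDerivWithinAt).neg.congr_deriv (by ring)
  have h := image_le_of_deriv_right_le_deriv_boundary (a := 0) (b := T)
    (f := fun s => -(y s * Real.exp (α * s))) (B := fun _ => -y 0) (B' := fun _ => 0)
    (fun t ht => (hF t (hsub ht)).continuousWithinAt.mono hsub)
    (fun t ht => (hF t (hsub (Ico_subset_Icc_self ht))).Ici_of_timeInterval hT ht)
    (by simp) continuousOn_const (fun t _ => hasDerivWithinAt_const _ _ _)
    (fun t ht => by
      have h1 := hge t (hsub (Ico_subset_Icc_self ht))
      exact neg_nonpos.2 (mul_nonneg (by linarith) (Real.exp_pos _).le))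
    (right_mem_Icc.2 hT.1)
  have h1 : y 0 ≤ y T * Real.exp (α * T) := neg_le_neg_iff.1 h
  calc y 0 * Real.exp (-α * T) ≤ y T * Real.exp (α * T) * Real.exp (-α * T) := by gcongr
    _ = y T := by rw [mul_assoc, ← Real.exp_add]; simp

namespace Problem

variable {nx nu nz : ℕ} {p : Problem nx nu nz}

/-- Along the closed loop the hard constraint of the program makes `h(x̂)` decay at rate at most
`α`; the error, which decays at rate at least `α`, never uses up the margin of `h(x̂)`. -/
theorem mem_safeSet_of_errorBound {tmax : EReal} {P : ℝ → Mat nx nx}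
    {π : ℝ → Vec nx → Vec nz → Vec nu} {x xh : ℝ → Vec nx} {ε η θ : ℝ} (htmax : 0 < tmax)
    (hπ : p.IsProgramController (timeInterval tmax) P π)
    (hcl : p.ClosedLoop (timeInterval tmax) P π x xh)
    (herr : ErrorBound (timeInterval tmax) ε η θ x xh) {Kh Kq : ℝ≥0}
    (hcbf : p.IsCBF θ (η * ‖x 0 - xh 0‖) Kh Kq)
    (h0 : 2 * Kh * (η * ‖x 0 - xh 0‖) ≤ p.h (x 0)) (hε : ‖x 0 - xh 0‖ < ε) :
    ∀ t ∈ timeInterval tmax, x t ∈ p.safeSet := by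
  set I := timeInterval tmax with hI
  have h0I : (0 : ℝ) ∈ I := ⟨le_rfl, by simpa using htmax⟩
  obtain ⟨D, hD, hsub, hh⟩ := hcbf.smooth
  set M₀ := η * ‖x 0 - xh 0‖ with hM₀
  have herr' := herr hε
  have hM : ‖x 0 - xh 0‖ ≤ M₀ := by simpa using herr' 0 h0I
  have hM0 : 0 ≤ M₀ := (norm_nonneg _).trans hM
  have hlip : ∀ t ∈ I, |p.h (x t) - p.h (xh t)| ≤ Kh * ‖x t - xh t‖ := fun t ht => by
    have h := hcbf.lipschitz_h.dist_le_mul (x t) (Or.inl (hcl.state_mem t ht)) (xh t)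
      (Or.inr (hcl.estimate_mem t ht))
    rwa [Real.dist_eq, dist_eq_norm] at h
  have hdec := mul_exp_le_of_deriv_ge (α := p.α) (tmax := tmax) (y := fun t => p.h (xh t))
    (y' := fun t => fderiv ℝ p.h (xh t) (p.f (xh t) + p.g (xh t) (π t (xh t) (p.q (x t)))
      + p.gain (minv (P t)) (xh t) (p.q (x t) - p.q (xh t))))
    (fun t ht => by
      have hxh : xh t ∈ p.dom := Or.inr (hcl.estimate_mem t ht)
      have h1 : HasFDerivAt p.h (fderiv ℝ p.h (xh t)) (xh t) :=
        ((hh.contDiffAt (hD.mem_nhds (hsub hxh))).differentiableAt two_ne_zero).hasFDerivAt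
      exact h1.comp_hasDerivWithinAt t (hcl.observer t ht))
    (fun t ht => by
      obtain ⟨δ, ⟨-, h1⟩, -⟩ := hπ t ht (xh t) (hcl.estimate_mem t ht) (p.q (x t))
      simp only [Lf, Lg, ContinuousLinearMap.comp_apply] at h1
      simp only [map_add]
      linarith)
  intro t ht
  refine ⟨hcl.state_mem t ht, ?_⟩
  have h1 := (abs_le.1 (hlip 0 h0I)).2
  have h2 := (abs_le.1 (hlip t ht)).1
  have h3 : Kh * ‖x 0 - xh 0‖ ≤ Kh * M₀ := by gcongr
  have h4 : (Kh : ℝ) * ‖x t - xh t‖ ≤ Kh * (M₀ * Real.exp (-θ * t)) := by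
    gcongr
    exact herr' t ht
  have h5 : Kh * M₀ * Real.exp (-p.α * t) ≤ p.h (xh 0) * Real.exp (-p.α * t) := by
    gcongr
    linarith
  have h6 : Real.exp (-θ * t) ≤ Real.exp (-p.α * t) :=
    Real.exp_le_exp.2 (by have := mul_le_mul_of_nonneg_right hcbf.α_le ht.1; linarith)
  have h7 : Kh * M₀ * Real.exp (-θ * t) ≤ Kh * M₀ * Real.exp (-p.α * t) := by gcongr
  have h8 := hdec t ht
  linarith

end Problem

theorem theorem3 {nx nu nz : ℕ} (p : Problem nx nu nz) (hp : p.Standing)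
    (hV : p.IsCLF) (hh : p.IsBarrierCandidate) :
    -- the program is feasible and has a unique minimizer, and the controller that it defines is
    -- piecewise continuous in `t` and Lipschitz continuous in `(x̂, z)`
    (∀ (tmax : EReal) (P : ℝ → Mat nx nx), 0 < tmax →
      p.UniformBounds (timeInterval tmax) P →
      PiecewiseContinuousOn P (timeInterval tmax) →
      (∀ t ∈ timeInterval tmax, ∀ xh ∈ p.Xhat, ∀ z : Vec nz,
        (∃ (u : Vec nu) (δ : ℝ), p.Feasible (minv (P t)) xh z u δ) ∧
        (∃! w : Vec nu × ℝ, p.IsMinimizer (minv (P t)) xh z w.1 w.2)) ∧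
      (∀ π : ℝ → Vec nx → Vec nz → Vec nu, p.IsProgramController (timeInterval tmax) P π →
        (∀ xh ∈ p.Xhat, ∀ z : Vec nz,
          PiecewiseContinuousOn (fun t => π t xh z) (timeInterval tmax)) ∧
        (∀ (J : Set ℝ) (Z : Set (Vec nz)), IsCompact J → J ⊆ timeInterval tmax →
          ContinuousOn P J → IsCompact Z → p.DistinctConfidence J Z P π →
          ∃ L : ℝ≥0, ∀ t ∈ J,
            LipschitzOnWith L (fun y : Vec nx × Vec nz => π t y.1 y.2) (p.Xhat ×ˢ Z)))) ∧
    -- the observer in the closed loop has an exponential error bound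
    (∃ ε η θ : ℝ, 0 < ε ∧ 0 < η ∧ p.κ / 2 < θ ∧
      ∀ (tmax : EReal) (P : ℝ → Mat nx nx) (π : ℝ → Vec nx → Vec nz → Vec nu)
        (x xh : ℝ → Vec nx), 0 < tmax →
        p.UniformBounds (timeInterval tmax) P →
        p.IsProgramController (timeInterval tmax) P π →
        p.ClosedLoop (timeInterval tmax) P π x xh →
        ErrorBound (timeInterval tmax) ε η θ x xh) ∧
    -- safety, for every known error bound for which `h` is a control barrier function
    (∀ ε η θ : ℝ, 0 < ε → 0 < η → p.κ / 2 < θ →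
      ∀ (tmax : EReal) (P : ℝ → Mat nx nx) (π : ℝ → Vec nx → Vec nz → Vec nu)
        (x xh : ℝ → Vec nx), 0 < tmax →
        p.UniformBounds (timeInterval tmax) P →
        p.IsProgramController (timeInterval tmax) P π →
        p.ClosedLoop (timeInterval tmax) P π x xh →
        ErrorBound (timeInterval tmax) ε η θ x xh →
        ∀ Kh Kq : ℝ≥0, p.IsCBF θ (η * ‖x 0 - xh 0‖) Kh Kq →
          x 0 ∈ p.safeSet → 2 * Kh * (η * ‖x 0 - xh 0‖) ≤ p.h (x 0) →
          xh 0 ∈ p.Xhat → ‖x 0 - xh 0‖ < ε →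
          ∀ t ∈ timeInterval tmax, x t ∈ p.safeSet) := by
  -- the relative degree excludes the trivial state space, on which `lambdaMin` is a junk value
  have hnx : NeZero nx := ⟨by
    rintro rfl
    refine hh.relDegreeOne 0 (Or.inl hp.zero_mem) (ContinuousLinearMap.ext fun u => ?_)
    rw [Problem.Lg, ContinuousLinearMap.comp_apply, Subsingleton.elim (p.g 0 u) 0, map_zero]
    rfl⟩
  refine ⟨fun tmax P _ hP hPc => ⟨fun t ht xh hxh z => ?_, fun π hπ => ⟨fun xh hxh z => ?_,
    fun J Z hJ hJI hPJ hZ hdist => ?_⟩⟩, Problem.exists_errorBound hp hV hh, ?_⟩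
  · have h := Problem.exists_unique_minimizer hp hh (hP t ht) (Or.inr hxh) z
    obtain ⟨w, hw⟩ := h.exists
    exact ⟨⟨w.1, w.2, hw.1⟩, h⟩
  · exact Problem.piecewiseContinuousOn_controller hp hV hh
      (fun T hT => Icc_subset_timeInterval hT) hP hPc hπ hxh z
  · exact Problem.lipschitzOnWith_controller hp hV hh hP hπ hJ hJI hPJ hZ hdist
  · intro ε η θ _ _ _ tmax P π x xh htmax _ hπ hcl herr Kh Kq hcbf _ h0 _ hε
    exact Problem.mem_safeSet_of_errorBound htmax hπ hcl herr hcbf h0 hε
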